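/- Let $\alpha$ be a set (the alphabet) with an involution $\tau\colon\alpha\to\alpha$ (fixed points are allowed). An *étale word* over $\alpha$ is a pair $(\mathcal A,w)$ where $\mathcal A$ is a set with a map $\mathcal A\to\alpha$, $A\mapsto|A|$, and $w$ is a finite word in the letters of $\mathcal A$. It is a *nanoword* if every letter of $\mathcal A$ occurs exactly twice in $w$. Two étale words are isomorphic if a bijection between their alphabets, compatible with the maps to $\alpha$, carries one word to the other. *Homotopy* of nanowords is the equivalence relation generated by isomorphism and the following moves on nanowords ($x,y,z,t$ are words): 1. $(\mathcal A,xAAy)\mapsto(\mathcal A\setminus\{A\},xy)$, where $x,y$ do not contain $A$; 2. $(\mathcal A,xAByBAz)\mapsto(\mathcal A\setminus\{A,B\},xyz)$ if $|A|=\tau(|B|)$, where $x,y,z$ do not contain $A,B$; 3. $(\mathcal A,xAByACzBCt)\mapsto(\mathcal A,xBAyCAzCBt)$ if $|A|=|B|=|C|$, where $x,y,z,t$ do not contain $A,B,C$. A word $w$ on $\alpha$ is an étale word with $\mathcal A=\alpha$ and the identity projection. Its *desingularization* is the nanoword $w^d$ with alphabet $\{A_{i,j} : A\in\mathcal A,\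 1\le i<j\le m_w(A)\}$, where $m_w(A)$ is the number of occurrences of $A$ in $w$ and $|A_{i,j}|=|A|$; the word $w^d$ is obtained from $w$ by deleting the letters that occur only once and replacing the $i$-th occurrence of each other letter $A$ by $A_{1,i}A_{2,i}\cdots A_{i-1,i}A_{i,i+1}A_{i,i+2}\cdots A_{i,m_w(A)}$. Words $v,w$ on $\alpha$ are *homotopic*, $v\simeq w$, if the nanowords $v^d,w^d$ are homotopic, and $w$ is *contractible* if $w^d$ is homotopic to the empty nanoword. **Theorem.** Let $a,b$ be two distinct letters of $\alpha$. Then: 1. The words $aaabb$, $aabba$, $abbaa$, $bbaaa$ are homotopic to each other; they are contractible if and only if $\tau(a)=a$. 2. The word $baaab$ is contractible if and only if $\tau(a)=a$. 3. The word $ababa$ is contractible if and only if $\tau(a)=b$. 4. The words $abaab$, $baaba$, $aabab$, $babaa$ are never contractible. 5. A non-contractible word from (2)–(4) is never homotopic to a word from (1). 6. Two non-contractible words from (2)–(4) are homotopic to each other if and only if they coincide letterwise, with the following exceptions: $aabab\simeq babaa\simeq baaab$ when $\tau(a)=b$. -/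

import Mathlib

/-! Words, étale words, nanowords, desingularization, and homotopy. -/

namespace Nano

universe u

open scoped Classical in
/-- The multiplicity of the letter `A` in the word `w`: the number of times it occurs. -/
noncomputable def mult {L : Type u} (w : List L) (A : L) : ℕ := w.count A

/-- A Gauss word on the alphabet `L`: every letter of `L` occurs exactly twice. -/
def IsGauss {L : Type u} (w : List L) : Prop := ∀ A : L, mult w A = 2

/-- An étale word over `α`: an `α`-alphabet (a set of letters with a projection to `α`)
together with a word in this alphabet. -/
structure EtaleWord (α : Type u) where
  /-- the letters of the `α`-alphabet -/
  Letter : Type u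
  /-- the projection `A ↦ |A|` -/
  proj : Letter → α
  /-- the word -/
  word : List Letter

/-- A word on `α`, regarded as an étale word: the `α`-alphabet is `α` itself with the
identity projection. -/
def EtaleWord.ofWord {α : Type u} (w : List α) : EtaleWord α := ⟨α, id, w⟩

/-- A nanoword over `α`: an étale word whose word is a Gauss word on its alphabet. -/
structure Nanoword (α : Type u) extends EtaleWord α where
  gauss : IsGauss word

/-- The empty nanoword. -/
def Nanoword.empty (α : Type u) : Nanoword α :=
  ⟨⟨PEmpty, PEmpty.elim, []⟩, fun A => A.elim⟩

/-- Isomorphism of étale words: a bijection of the alphabets that commutes with the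
projections to `α` and carries one word to the other. -/
def EtaleWord.Iso {α : Type u} (U V : EtaleWord α) : Prop :=
  ∃ f : U.Letter ≃ V.Letter, (∀ A, V.proj (f A) = U.proj A) ∧ V.word = U.word.map f

/-! ### Desingularization -/

section Desingularization

variable {L : Type u}

/-- For words `pre` and `w`, the list of the letters of `w`, each `A` paired with the number `i`
such that this is the `i`-th entry of `A` in the concatenation of `pre` and `w`. -/
noncomputable def occurrences (pre : List L) : List L → List (L × ℕ)
  | [] => []
  | A :: w => (A, mult pre A + 1) :: occurrences (pre ++ [A]) w

/-- The word `A_{1,i} A_{2,i} ⋯ A_{i-1,i} A_{i,i+1} A_{i,i+2} ⋯ A_{i,m}`, with the triple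
`(A, i, j)` standing for `A_{i,j}`. It is empty for `i = m = 1`. -/
def block (m : ℕ) (A : L) (i : ℕ) : List (L × ℕ × ℕ) :=
  (List.range' 1 (i - 1)).map (fun j => (A, j, i)) ++
    (List.range' (i + 1) (m - i)).map (fun j => (A, i, j))

/-- The result of replacing, for all `A` and `i`, the `i`-th entry of `A` in `w` by
`A_{1,i} ⋯ A_{i-1,i} A_{i,i+1} ⋯ A_{i,m}`, where `m` is the multiplicity of `A` in `w`
(so that a letter of multiplicity one is deleted). -/
noncomputable def rawDesing (w : List L) : List (L × ℕ × ℕ) :=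
  (occurrences [] w).flatMap fun q => block (mult w q.1) q.1 q.2

/-- The condition `1 ≤ i < j ≤ m_w(A)` on a triple `(A, i, j)`. -/
def IsDesingLetter (w : List L) (t : L × ℕ × ℕ) : Prop :=
  1 ≤ t.2.1 ∧ t.2.1 < t.2.2 ∧ t.2.2 ≤ mult w t.1

theorem mult_eq_count [DecidableEq L] (w : List L) (A : L) : mult w A = w.count A := by
  unfold mult
  congr!

theorem mult_map_of_injective {K M : Type*} (f : K → M) (hf : Function.Injective f)
    (w : List K) (A : K) : mult (w.map f) (f A) = mult w A := by
  classical
  rw [mult_eq_count, mult_eq_count, List.count_map_of_injective w f hf]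

theorem mult_eq_zero_of_not_mem {w : List L} {A : L} (h : A ∉ w) : mult w A = 0 :=
  by classical exact List.count_eq_zero_of_not_mem h

theorem mult_cons (A B : L) (w : List L) [Decidable (A = B)] :
    mult (A :: w) B = mult w B + if A = B then 1 else 0 := by
  classical
  simp only [mult, List.count_cons, beq_iff_eq]

theorem mult_append (u v : List L) (B : L) : mult (u ++ v) B = mult u B + mult v B := by
  classical
  simp [mult, List.count_append]

theorem mult_nil (B : L) : mult ([] : List L) B = 0 := by
  simp [mult]

theorem mem_occurrences (w : List L) : ∀ (pre : List L) (q : L × ℕ), q ∈ occurrences pre w →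
    1 ≤ q.2 ∧ q.2 ≤ mult (pre ++ w) q.1 := by
  classical
  induction w with
  | nil => intro pre q hq; simp [occurrences] at hq
  | cons A w ih =>
    intro pre q hq
    simp only [occurrences, List.mem_cons] at hq
    rcases hq with rfl | hq
    · simp [mult_append, mult_cons]
    · simpa using ih (pre ++ [A]) q hq

theorem isDesingLetter_of_mem_rawDesing (w : List L) (t : L × ℕ × ℕ) (ht : t ∈ rawDesing w) :
    IsDesingLetter w t := by
  obtain ⟨⟨A, i⟩, hq, ht⟩ := List.mem_flatMap.1 ht
  have h := mem_occurrences w [] _ hq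
  simp only [List.nil_append] at h
  simp only [block, List.mem_append, List.mem_map, List.mem_range'_1] at ht
  unfold IsDesingLetter
  rcases ht with ⟨j, hj, rfl⟩ | ⟨j, hj, rfl⟩ <;> dsimp only <;> omega

open scoped Classical in
theorem mult_block (m : ℕ) (A : L) (p : ℕ) (B : L) (i j : ℕ) (h1 : 1 ≤ i) (h2 : i < j)
    (h3 : j ≤ m) :
    mult (block m A p) (B, i, j) = if A = B ∧ (p = i ∨ p = j) then 1 else 0 := by
  have e1 : Function.Injective (fun j : ℕ => (A, j, p)) := fun x y h => by simpa using h
  have e2 : Function.Injective (fun j : ℕ => (A, p, j)) := fun x y h => by simpa using h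
  by_cases hA : A = B
  · subst hA
    have c1 : mult ((List.range' 1 (p - 1)).map (fun j => (A, j, p))) (A, i, j) =
        if p = j then 1 else 0 := by
      split_ifs with h
      · subst h
        refine (mult_map_of_injective _ e1 _ i).trans ?_
        rw [mult_eq_count, List.count_eq_one_of_mem List.nodup_range']
        rw [List.mem_range'_1]; omega
      · refine mult_eq_zero_of_not_mem fun hm => ?_
        obtain ⟨x, -, hx⟩ := List.mem_map.1 hm
        simp only [Prod.mk.injEq] at hx
        exact h hx.2.2
    have c2 : mult ((List.range' (p + 1) (m - p)).map (fun j => (A, p, j))) (A, i, j) =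
        if p = i then 1 else 0 := by
      split_ifs with h
      · subst h
        refine (mult_map_of_injective _ e2 _ j).trans ?_
        rw [mult_eq_count, List.count_eq_one_of_mem List.nodup_range']
        rw [List.mem_range'_1]; omega
      · refine mult_eq_zero_of_not_mem fun hm => ?_
        obtain ⟨x, -, hx⟩ := List.mem_map.1 hm
        simp only [Prod.mk.injEq] at hx
        exact h hx.2.1
    rw [block, mult_append, c1, c2]
    by_cases hi : p = i <;> by_cases hj : p = j <;> simp [hi, hj] <;> omega
  · rw [if_neg (fun h => hA h.1)]
    refine mult_eq_zero_of_not_mem fun hm => ?_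
    simp only [block, List.mem_append, List.mem_map, Prod.mk.injEq] at hm
    rcases hm with ⟨x, -, hx⟩ | ⟨x, -, hx⟩ <;> exact hA hx.1

open scoped Classical in
theorem mult_flatMap_occurrences (B : L) (i j : ℕ) (m : L → ℕ) (h1 : 1 ≤ i) (h2 : i < j)
    (h3 : j ≤ m B) (w : List L) : ∀ pre : List L,
    mult ((occurrences pre w).flatMap fun q => block (m q.1) q.1 q.2) (B, i, j) =
      (if mult pre B < i ∧ i ≤ mult (pre ++ w) B then 1 else 0) +
        (if mult pre B < j ∧ j ≤ mult (pre ++ w) B then 1 else 0) := by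
  induction w with
  | nil =>
    intro pre
    simp only [occurrences, List.flatMap_nil, mult_nil, List.append_nil]
    rw [if_neg (by omega), if_neg (by omega)]
  | cons A w ih =>
    intro pre
    simp only [occurrences, List.flatMap_cons, mult_append]
    rw [ih (pre ++ [A])]
    simp only [mult_append, mult_cons, mult_nil]
    by_cases hA : A = B
    · subst hA
      rw [mult_block _ _ _ _ _ _ h1 h2 h3]
      simp only [if_true, true_and]
      split_ifs <;> omega
    · have hz : mult (block (m A) A (mult pre A + 1)) (B, i, j) = 0 := by
        refine mult_eq_zero_of_not_mem fun hm => ?_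
        simp only [block, List.mem_append, List.mem_map, Prod.mk.injEq] at hm
        rcases hm with ⟨x, -, hx⟩ | ⟨x, -, hx⟩ <;> exact hA hx.1
      rw [hz]
      simp only [if_neg hA, add_zero, zero_add]

/-- The word `w^d` in the alphabet of all `A_{i,j} = (A, i, j)` with `1 ≤ i < j ≤ m_w(A)`. -/
noncomputable def desingWord (w : List L) : List {t : L × ℕ × ℕ // IsDesingLetter w t} :=
  (rawDesing w).attachWith (IsDesingLetter w) (isDesingLetter_of_mem_rawDesing w)

theorem isGauss_desingWord (w : List L) : IsGauss (desingWord w) := by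
  classical
  intro t
  obtain ⟨h1, h2, h3⟩ := t.2
  have key := mult_flatMap_occurrences t.1.1 t.1.2.1 t.1.2.2 (mult w) h1 h2 h3 w []
  simp only [mult_nil, List.nil_append] at key
  rw [if_pos ⟨by omega, by omega⟩, if_pos ⟨by omega, h3⟩] at key
  have hval : (desingWord w).map Subtype.val = rawDesing w :=
    List.attachWith_map_subtype_val _
  rw [← mult_map_of_injective Subtype.val Subtype.val_injective, hval]
  exact key

end Desingularization

/-- The desingularization of an étale word. Its alphabet consists of all
`A_{i,j} = (A, i, j)` with `1 ≤ i < j ≤ m_w(A)`, and `|A_{i,j}| = |A|`. -/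
noncomputable def EtaleWord.desing {α : Type u} (U : EtaleWord α) : Nanoword α where
  Letter := {t : U.Letter × ℕ × ℕ // IsDesingLetter U.word t}
  proj := fun t => U.proj t.1.1
  word := desingWord U.word
  gauss := isGauss_desingWord U.word

/-! ### Homotopy -/

/-- The alphabet `L - s`. -/
abbrev Without (L : Type u) (s : Set L) : Type u := {C : L // C ∉ s}

/-- A word on the alphabet `L - s`, regarded as a word on `L`. -/
def incl {L : Type u} {s : Set L} (x : List (Without L s)) : List L := x.map Subtype.val

/-- The three homotopy moves on nanowords over `α`, for the homotopy data `τ`, `S`.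
The letters `A`, `B`, `C` are automatically distinct, because the words are Gauss words, and
the result of a move on a nanoword is automatically a nanoword (so `hV` follows from `hU`). -/
inductive HomotopyMove {α : Type u} (τ : α → α) (S : Set (α × α × α)) :
    Nanoword α → Nanoword α → Prop
  /-- `(𝒜, xAAy) ↦ (𝒜 - {A}, xy)` -/
  | first (L : Type u) (p : L → α) (A : L) (x y : List (Without L {A}))
      (hU : IsGauss (incl x ++ [A, A] ++ incl y)) (hV : IsGauss (x ++ y)) :
      HomotopyMove τ S ⟨⟨L, p, incl x ++ [A, A] ++ incl y⟩, hU⟩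
        ⟨⟨Without L {A}, fun D => p D, x ++ y⟩, hV⟩
  /-- `(𝒜, xAByBAz) ↦ (𝒜 - {A, B}, xyz)` if `|A| = τ(|B|)` -/
  | second (L : Type u) (p : L → α) (A B : L) (hAB : p A = τ (p B))
      (x y z : List (Without L {A, B}))
      (hU : IsGauss (incl x ++ [A, B] ++ incl y ++ [B, A] ++ incl z))
      (hV : IsGauss (x ++ y ++ z)) :
      HomotopyMove τ S ⟨⟨L, p, incl x ++ [A, B] ++ incl y ++ [B, A] ++ incl z⟩, hU⟩
        ⟨⟨Without L {A, B}, fun D => p D, x ++ y ++ z⟩, hV⟩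
  /-- `(𝒜, xAByACzBCt) ↦ (𝒜, xBAyCAzCBt)` if `(|A|, |B|, |C|) ∈ S` -/
  | third (L : Type u) (p : L → α) (A B C : L) (hABC : (p A, p B, p C) ∈ S)
      (x y z t : List (Without L {A, B, C}))
      (hU : IsGauss
        (incl x ++ [A, B] ++ incl y ++ [A, C] ++ incl z ++ [B, C] ++ incl t))
      (hV : IsGauss
        (incl x ++ [B, A] ++ incl y ++ [C, A] ++ incl z ++ [C, B] ++ incl t)) :
      HomotopyMove τ S
        ⟨⟨L, p, incl x ++ [A, B] ++ incl y ++ [A, C] ++ incl z ++ [B, C] ++ incl t⟩, hU⟩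
        ⟨⟨L, p, incl x ++ [B, A] ++ incl y ++ [C, A] ++ incl z ++ [C, B] ++ incl t⟩, hV⟩

/-- `S`-homotopy of nanowords: the equivalence relation generated by isomorphisms and the
homotopy moves. -/
def Nanoword.Homotopic {α : Type u} (τ : α → α) (S : Set (α × α × α)) :
    Nanoword α → Nanoword α → Prop :=
  Relation.EqvGen fun U V => U.toEtaleWord.Iso V.toEtaleWord ∨ HomotopyMove τ S U V

/-- The diagonal of `α³`. -/
def diagonal (α : Type u) : Set (α × α × α) := {s | ∃ a : α, s = (a, a, a)}

/-- Homotopy of words on `α`, with `S` the diagonal: homotopy of the desingularizations. -/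
def Homotopic {α : Type u} (τ : α → α) (v w : List α) : Prop :=
  (EtaleWord.ofWord v).desing.Homotopic τ (diagonal α) (EtaleWord.ofWord w).desing

/-- A word on `α` is contractible if its desingularization is homotopic to the empty nanoword. -/
def Contractible {α : Type u} (τ : α → α) (w : List α) : Prop :=
  (EtaleWord.ofWord w).desing.Homotopic τ (diagonal α) (Nanoword.empty α)

end Nano

/-! The homotopies come from a few explicit moves, and the non-homotopies from invariants evaluated
on finitely many words in four letters.

Positive part. In each word homotopic to `aaabb` the two entries of `b_{1,2}` are adjacent, so the
first move leaves the desingularization of `aaa`. The third move turns that into `a_{13} a_{12}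
a_{23} a_{12} a_{23} a_{13}`, which collapses when `τ a = a` by the derived move deleting `AB⋯AB`
for `|A| = τ|B|` (`WordHom.second'`). The same device contracts `baaab` when `τ a = a`. If `τ a =
b`, then `ababa` contracts, and `baaab`, `aabab`, `babaa` all reduce to one nanoword `ABAB` over
`a`.

Negative part. Let each letter act on a set of states by a permutation `ρ` at its first entry and by
the inverse at its second, with `ρ (τ x) = (ρ x)⁻¹`. The moves do not disturb the states seen by
letters outside them, so a sum over letters of a function of the state before the first entry and
the state after the second is invariant under mild conditions (`isWordInvariant_letterSum`). If `τ a
≠ b`, then `a` acts as the rotation and `b` as a reflection in a dihedral group: of order 4 if `τ a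
= a`, where the rotation must be an involution, and of order 10 otherwise. If `τ a = b`, the letters
act as opposite rotations of order 5.

In this last case such sums do not separate `aaa` from `ABAB`. A secondary invariant does: the
parity of the number of pairs of a letter with displacement 1 modulo 3 and a letter with
displacement 0 such that the first enters between the two entries of the second
(`isWordInvariant_pairSum`). -/

namespace Nano

universe u

/-! ### Nanowords up to isomorphism as words over `ℕ × α` -/

section Spelling

theorem IsGauss.mem {L : Type u} {w : List L} (h : IsGauss w) (A : L) : A ∈ w := by
  by_contra hA
  have := h A
  rw [mult_eq_zero_of_not_mem hA] at this
  omega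

theorem mult_eq_zero_iff {K : Type*} {w : List K} {A : K} : mult w A = 0 ↔ A ∉ w := by
  classical
  rw [mult_eq_count, List.count_eq_zero]

theorem isGauss_of_map {K L : Type*} {f : L → K} (hf : Function.Injective f) {l : List L}
    (h : ∀ A, mult (l.map f) (f A) = 2) : IsGauss l := fun A => by
  rw [← mult_map_of_injective f hf]
  exact h A

variable {α : Type u} {τ : α → α}

/-- The nanoword `U` is spelled by the word `w` in the letters `ℕ × α`, where the letter `(n, a)`
projects to `a`. -/
def Spells (U : Nanoword α) (w : List (ℕ × α)) : Prop :=
  ∃ f : U.Letter → ℕ × α, Function.Injective f ∧ (∀ A, (f A).2 = U.proj A) ∧ U.word.map f = w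

/-- Every letter of a nanoword occurs in its word, so a spelling determines the whole alphabet.
Hence nanowords can be replaced by plain words, and alphabets that change type under the moves need
not be handled later. -/
theorem Spells.iso {U V : Nanoword α} {w : List (ℕ × α)} (hU : Spells U w) (hV : Spells V w) :
    U.toEtaleWord.Iso V.toEtaleWord := by
  obtain ⟨f, hf, hfp, hfw⟩ := hU
  obtain ⟨g, hg, hgp, hgw⟩ := hV
  have h1 : ∀ A, ∃ B, g B = f A := fun A => by
    have : f A ∈ w := hfw ▸ List.mem_map_of_mem (U.gauss.mem A)
    rw [← hgw] at this
    obtain ⟨B, -, hB⟩ := List.mem_map.1 this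
    exact ⟨B, hB⟩
  choose h hh using h1
  have hinj : Function.Injective h := fun A B e => hf (by rw [← hh, ← hh, e])
  have hsurj : Function.Surjective h := fun B => by
    have : g B ∈ w := hgw ▸ List.mem_map_of_mem (V.gauss.mem B)
    rw [← hfw] at this
    obtain ⟨A, -, hA⟩ := List.mem_map.1 this
    exact ⟨A, hg (by rw [hh, hA])⟩
  refine ⟨Equiv.ofBijective h ⟨hinj, hsurj⟩, fun A => ?_, ?_⟩
  · change V.proj (h A) = U.proj A
    rw [← hgp, hh, hfp]
  · apply List.map_injective_iff.2 hg
    change V.word.map g = (U.word.map h).map g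
    rw [List.map_map, hgw, ← hfw]
    exact List.map_congr_left fun A _ => (hh A).symm

/-- Every letter that occurs in `w` occurs twice. -/
def IsDouble {K : Type u} (w : List K) : Prop := ∀ k ∈ w, mult w k = 2

theorem Spells.isDouble {U : Nanoword α} {w : List (ℕ × α)} (h : Spells U w) : IsDouble w := by
  obtain ⟨f, hf, -, rfl⟩ := h
  intro k hk
  obtain ⟨A, -, rfl⟩ := List.mem_map.1 hk
  rw [mult_map_of_injective f hf]
  exact U.gauss A

theorem exists_spells {w : List (ℕ × α)} (h : IsDouble w) : ∃ U : Nanoword α, Spells U w := by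
  refine ⟨⟨⟨{k // k ∈ w}, fun k => k.1.2, w.attach⟩, isGauss_of_map Subtype.val_injective ?_⟩,
    Subtype.val, Subtype.val_injective, fun _ => rfl, List.attach_map_subtype_val w⟩
  intro A
  rw [List.attach_map_subtype_val]
  exact h A.1 A.2

theorem Spells.rename {U : Nanoword α} {w : List (ℕ × α)} (h : Spells U w) {g : ℕ × α → ℕ × α}
    (hg : Function.Injective g) (hp : ∀ k ∈ w, (g k).2 = k.2) : Spells U (w.map g) := by
  obtain ⟨f, hf, hfp, rfl⟩ := h
  refine ⟨g ∘ f, hg.comp hf, fun A => ?_, by simp⟩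
  rw [Function.comp_apply, hp _ (List.mem_map_of_mem (U.gauss.mem A)), hfp]

/-- Homotopy of the nanowords spelled by `v` and `w`. -/
def WordHom (τ : α → α) (v w : List (ℕ × α)) : Prop :=
  ∃ U V : Nanoword α, Spells U v ∧ Spells V w ∧ U.Homotopic τ (diagonal α) V

namespace WordHom

theorem refl {w : List (ℕ × α)} (h : IsDouble w) : WordHom τ w w := by
  obtain ⟨U, hU⟩ := exists_spells h
  exact ⟨U, U, hU, hU, .refl _⟩

theorem symm {v w : List (ℕ × α)} (h : WordHom τ v w) : WordHom τ w v := by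
  obtain ⟨U, V, hU, hV, h⟩ := h
  exact ⟨V, U, hV, hU, h.symm⟩

theorem trans {v w x : List (ℕ × α)} (h : WordHom τ v w) (h' : WordHom τ w x) :
    WordHom τ v x := by
  obtain ⟨U, V, hU, hV, h⟩ := h
  obtain ⟨V', X, hV', hX, h'⟩ := h'
  exact ⟨U, X, hU, hX, h.trans _ _ _ (.trans _ _ _ (.rel _ _ (.inl (hV.iso hV'))) h')⟩

theorem isDouble_left {v w : List (ℕ × α)} (h : WordHom τ v w) : IsDouble v := by
  obtain ⟨U, V, hU, hV, h⟩ := h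
  exact hU.isDouble

theorem isDouble_right {v w : List (ℕ × α)} (h : WordHom τ v w) : IsDouble w :=
  h.symm.isDouble_left

theorem homotopic {U V : Nanoword α} {v w : List (ℕ × α)} (hU : Spells U v) (hV : Spells V w)
    (h : WordHom τ v w) : U.Homotopic τ (diagonal α) V := by
  obtain ⟨U', V', hU', hV', h⟩ := h
  exact .trans _ _ _ (.rel _ _ (.inl (hU.iso hU')))
    (.trans _ _ _ h (.rel _ _ (.inl (hV'.iso hV))))

theorem rename {v w : List (ℕ × α)} (h : WordHom τ v w) {g : ℕ × α → ℕ × α}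
    (hg : Function.Injective g) (hp : ∀ k ∈ w, (g k).2 = k.2) : WordHom τ v (w.map g) := by
  obtain ⟨U, V, hU, hV, h⟩ := h
  exact ⟨U, V, hU, hV.rename hg hp, h⟩

/-- Replacing the letter `A` by a letter `B` with the same projection. -/
theorem replace [DecidableEq α] {v w : List (ℕ × α)} (h : WordHom τ v w) {A B : ℕ × α}
    (hAB : A.2 = B.2) : WordHom τ v (w.map (Equiv.swap A B)) := by
  refine h.rename (Equiv.injective _) fun k _ => ?_
  rw [Equiv.swap_apply_def]
  split_ifs with h1 h2
  · rw [h1, hAB]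
  · rw [h2, hAB]
  · rfl

end WordHom

/-- Serves to write a subword of `w` over the alphabet that remains after a move, as the
constructors of `HomotopyMove` require. -/
theorem exists_lift {K : Type u} (w x : List K) (s : Set {k // k ∈ w}) (h : ∀ k ∈ x, k ∈ w)
    (hs : ∀ D ∈ s, D.1 ∉ x) :
    ∃ X : List (Without {k // k ∈ w} s), (incl X).map Subtype.val = x := by
  refine ⟨x.pmap (fun k hk => ⟨⟨k, hk.1⟩, hk.2⟩)
    (P := fun k => ∃ h : k ∈ w, (⟨k, h⟩ : {k // k ∈ w}) ∉ s)
    fun k hk => ⟨h k hk, fun h' => hs _ h' hk⟩, ?_⟩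
  simp [incl, List.map_pmap]

theorem spells_of_map_val {w : List (ℕ × α)} {s : Set {k // k ∈ w}}
    {l : List (Without {k // k ∈ w} s)} (h : IsGauss l) {v : List (ℕ × α)}
    (hv : (incl l).map Subtype.val = v) :
    Spells ⟨⟨Without {k // k ∈ w} s, fun D => D.1.1.2, l⟩, h⟩ v := by
  refine ⟨fun D => D.1.1, Subtype.val_injective.comp Subtype.val_injective, fun _ => rfl, ?_⟩
  rw [← hv, incl, List.map_map]
  rfl

theorem incl_append {L : Type u} {s : Set L} (x y : List (Without L s)) :
    incl (x ++ y) = incl x ++ incl y := List.map_append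

theorem isGauss_without {w : List (ℕ × α)} {s : Set {k // k ∈ w}}
    {l : List (Without {k // k ∈ w} s)}
    (h : ∀ k (hk : k ∈ w), (⟨k, hk⟩ : {k // k ∈ w}) ∉ s →
      mult ((incl l).map Subtype.val) k = 2) : IsGauss l := by
  refine isGauss_of_map (f := fun D => D.1.1)
    (Subtype.val_injective.comp Subtype.val_injective) fun D => ?_
  rw [← h D.1.1 D.1.2 D.2, incl, List.map_map]
  rfl

theorem WordHom.first {x y : List (ℕ × α)} {A : ℕ × α} (h : IsDouble (x ++ [A, A] ++ y)) :
    WordHom τ (x ++ [A, A] ++ y) (x ++ y) := by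
  classical
  have hA := h A (by simp)
  simp only [mult_append, mult_cons, mult_nil, if_true] at hA
  have hx : A ∉ x := mult_eq_zero_iff.1 (by omega)
  have hy : A ∉ y := mult_eq_zero_iff.1 (by omega)
  let w := x ++ [A, A] ++ y
  let A' : {k // k ∈ w} := ⟨A, by simp [w]⟩
  obtain ⟨X, hX⟩ := exists_lift w x {A'} (by simp +contextual [w]) (by rintro _ rfl; exact hx)
  obtain ⟨Y, hY⟩ := exists_lift w y {A'} (by simp +contextual [w]) (by rintro _ rfl; exact hy)
  have e : (incl X ++ [A', A'] ++ incl Y).map Subtype.val = w := by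
    simp [hX, hY, w, A']
  have e' : (incl (X ++ Y)).map Subtype.val = x ++ y := by
    simp [incl_append, hX, hY]
  have hU : IsGauss (incl X ++ [A', A'] ++ incl Y) :=
    isGauss_of_map Subtype.val_injective fun D => by rw [e]; exact h D.1 D.2
  have hV : IsGauss (X ++ Y) := isGauss_without fun k hk hs => by
    have := h k hk
    have hkA : A ≠ k := fun hh => hs (Subtype.ext hh.symm)
    rw [e']
    simpa [mult_append, mult_cons, mult_nil, hkA] using this
  exact ⟨_, _, ⟨Subtype.val, Subtype.val_injective, fun _ => rfl, e⟩, spells_of_map_val hV e',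
    .rel _ _ (.inr (.first _ (fun k => k.1.2) A' X Y hU hV))⟩

theorem WordHom.second {x y z : List (ℕ × α)} {A B : ℕ × α}
    (h : IsDouble (x ++ [A, B] ++ y ++ [B, A] ++ z)) (hAB : A.2 = τ B.2) :
    WordHom τ (x ++ [A, B] ++ y ++ [B, A] ++ z) (x ++ y ++ z) := by
  classical
  have hA := h A (by simp)
  have hB := h B (by simp)
  simp only [mult_append, mult_cons, mult_nil, if_true] at hA hB
  have hxA : A ∉ x := mult_eq_zero_iff.1 (by omega)
  have hyA : A ∉ y := mult_eq_zero_iff.1 (by omega)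
  have hzA : A ∉ z := mult_eq_zero_iff.1 (by omega)
  have hxB : B ∉ x := mult_eq_zero_iff.1 (by omega)
  have hyB : B ∉ y := mult_eq_zero_iff.1 (by omega)
  have hzB : B ∉ z := mult_eq_zero_iff.1 (by omega)
  let w := x ++ [A, B] ++ y ++ [B, A] ++ z
  let A' : {k // k ∈ w} := ⟨A, by simp [w]⟩
  let B' : {k // k ∈ w} := ⟨B, by simp [w]⟩
  obtain ⟨X, hX⟩ := exists_lift w x {A', B'} (by simp +contextual [w])
    (by rintro _ (rfl | rfl) <;> assumption)
  obtain ⟨Y, hY⟩ := exists_lift w y {A', B'} (by simp +contextual [w])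
    (by rintro _ (rfl | rfl) <;> assumption)
  obtain ⟨Z, hZ⟩ := exists_lift w z {A', B'} (by simp +contextual [w])
    (by rintro _ (rfl | rfl) <;> assumption)
  have e : (incl X ++ [A', B'] ++ incl Y ++ [B', A'] ++ incl Z).map Subtype.val = w := by
    simp [hX, hY, hZ, w, A', B']
  have e' : (incl (X ++ Y ++ Z)).map Subtype.val = x ++ y ++ z := by
    simp [incl_append, hX, hY, hZ]
  have hU : IsGauss (incl X ++ [A', B'] ++ incl Y ++ [B', A'] ++ incl Z) :=
    isGauss_of_map Subtype.val_injective fun D => by rw [e]; exact h D.1 D.2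
  have hV : IsGauss (X ++ Y ++ Z) := isGauss_without fun k hk hs => by
    have := h k hk
    have hkA : A ≠ k := fun hh => hs (.inl (Subtype.ext hh.symm))
    have hkB : B ≠ k := fun hh => hs (.inr (Subtype.ext hh.symm))
    rw [e']
    simpa [mult_append, mult_cons, mult_nil, hkA, hkB] using this
  exact ⟨_, _, ⟨Subtype.val, Subtype.val_injective, fun _ => rfl, e⟩, spells_of_map_val hV e',
    .rel _ _ (.inr (.second _ (fun k => k.1.2) A' B' hAB X Y Z hU hV))⟩

theorem IsDouble.perm {K : Type u} {v w : List K} (h : IsDouble v) (hp : v.Perm w) :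
    IsDouble w := fun k hk => by
  classical
  rw [mult_eq_count, ← hp.count_eq, ← mult_eq_count]
  exact h k (hp.mem_iff.2 hk)

theorem perm_third {K : Type u} (x y z t : List K) (A B C : K) :
    (x ++ [A, B] ++ y ++ [A, C] ++ z ++ [B, C] ++ t).Perm
      (x ++ [B, A] ++ y ++ [C, A] ++ z ++ [C, B] ++ t) := by
  have h (A B : K) : [A, B].Perm [B, A] := List.Perm.swap _ _ _
  exact (((((((List.Perm.refl x).append (h A B)).append_right y).append (h A C)).append_right
    z).append (h B C)).append_right t)

theorem WordHom.third {x y z t : List (ℕ × α)} {A B C : ℕ × α}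
    (h : IsDouble (x ++ [A, B] ++ y ++ [A, C] ++ z ++ [B, C] ++ t)) (hAB : A.2 = B.2)
    (hAC : A.2 = C.2) :
    WordHom τ (x ++ [A, B] ++ y ++ [A, C] ++ z ++ [B, C] ++ t)
      (x ++ [B, A] ++ y ++ [C, A] ++ z ++ [C, B] ++ t) := by
  classical
  have hA := h A (by simp)
  have hB := h B (by simp)
  have hC := h C (by simp)
  simp only [mult_append, mult_cons, mult_nil, if_true] at hA hB hC
  have hxA : A ∉ x := mult_eq_zero_iff.1 (by omega)
  have hyA : A ∉ y := mult_eq_zero_iff.1 (by omega)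
  have hzA : A ∉ z := mult_eq_zero_iff.1 (by omega)
  have htA : A ∉ t := mult_eq_zero_iff.1 (by omega)
  have hxB : B ∉ x := mult_eq_zero_iff.1 (by omega)
  have hyB : B ∉ y := mult_eq_zero_iff.1 (by omega)
  have hzB : B ∉ z := mult_eq_zero_iff.1 (by omega)
  have htB : B ∉ t := mult_eq_zero_iff.1 (by omega)
  have hxC : C ∉ x := mult_eq_zero_iff.1 (by omega)
  have hyC : C ∉ y := mult_eq_zero_iff.1 (by omega)
  have hzC : C ∉ z := mult_eq_zero_iff.1 (by omega)
  have htC : C ∉ t := mult_eq_zero_iff.1 (by omega)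
  let w := x ++ [A, B] ++ y ++ [A, C] ++ z ++ [B, C] ++ t
  let A' : {k // k ∈ w} := ⟨A, by simp [w]⟩
  let B' : {k // k ∈ w} := ⟨B, by simp [w]⟩
  let C' : {k // k ∈ w} := ⟨C, by simp [w]⟩
  obtain ⟨X, hX⟩ := exists_lift w x {A', B', C'} (by simp +contextual [w])
    (by rintro _ (rfl | rfl | rfl) <;> assumption)
  obtain ⟨Y, hY⟩ := exists_lift w y {A', B', C'} (by simp +contextual [w])
    (by rintro _ (rfl | rfl | rfl) <;> assumption)
  obtain ⟨Z, hZ⟩ := exists_lift w z {A', B', C'} (by simp +contextual [w])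
    (by rintro _ (rfl | rfl | rfl) <;> assumption)
  obtain ⟨T, hT⟩ := exists_lift w t {A', B', C'} (by simp +contextual [w])
    (by rintro _ (rfl | rfl | rfl) <;> assumption)
  have e : (incl X ++ [A', B'] ++ incl Y ++ [A', C'] ++ incl Z ++ [B', C'] ++ incl T).map
      Subtype.val = w := by
    simp [hX, hY, hZ, hT, w, A', B', C']
  have e' : (incl X ++ [B', A'] ++ incl Y ++ [C', A'] ++ incl Z ++ [C', B'] ++ incl T).map
      Subtype.val = x ++ [B, A] ++ y ++ [C, A] ++ z ++ [C, B] ++ t := by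
    simp [hX, hY, hZ, hT, A', B', C']
  have hU : IsGauss (incl X ++ [A', B'] ++ incl Y ++ [A', C'] ++ incl Z ++ [B', C'] ++ incl T) :=
    isGauss_of_map Subtype.val_injective fun D => by rw [e]; exact h D.1 D.2
  have hV : IsGauss (incl X ++ [B', A'] ++ incl Y ++ [C', A'] ++ incl Z ++ [C', B'] ++ incl T) :=
    isGauss_of_map Subtype.val_injective fun D => by
      rw [e']
      have hp := perm_third x y z t A B C
      exact h.perm hp D.1 (hp.mem_iff.1 D.2)
  refine ⟨_, _, ⟨Subtype.val, Subtype.val_injective, fun _ => rfl, e⟩,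
    ⟨Subtype.val, Subtype.val_injective, fun _ => rfl, e'⟩,
    .rel _ _ (.inr (.third _ (fun k => k.1.2) A' B' C' ?_ X Y Z T hU hV))⟩
  exact ⟨A.2, by rw [hAC, ← hAC, ← hAB]⟩

end Spelling

/-! ### Further moves that follow from the three defining ones -/

section DerivedMoves

variable {α : Type u} {τ : α → α}

theorem IsDouble.cons_cons {K : Type u} {w : List K} (h : IsDouble w) {A : K} (hA : A ∉ w) :
    IsDouble (A :: A :: w) := by
  classical
  intro k hk
  by_cases hkA : A = k
  · subst hkA
    simp [mult_cons, mult_eq_zero_iff.2 hA]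
  · simpa [mult_cons, hkA] using h k (by simpa [Ne.symm hkA] using hk)

theorem WordHom.insert_first {x y : List (ℕ × α)} (h : IsDouble (x ++ y)) {A : ℕ × α}
    (hx : A ∉ x) (hy : A ∉ y) : WordHom τ (x ++ y) (x ++ [A, A] ++ y) := by
  classical
  refine (WordHom.first ((h.cons_cons (A := A) (by simp [hx, hy])).perm ?_)).symm
  rw [List.perm_iff_count]
  intro k
  simp only [List.count_append, List.count_cons, List.count_nil]
  omega

theorem WordHom.insert_second {x y z : List (ℕ × α)} (h : IsDouble (x ++ y ++ z)) {A B : ℕ × α}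
    (hA : A ∉ x ++ y ++ z) (hB : B ∉ x ++ y ++ z) (hne : A ≠ B) (hAB : A.2 = τ B.2) :
    WordHom τ (x ++ y ++ z) (x ++ [A, B] ++ y ++ [B, A] ++ z) := by
  classical
  refine (WordHom.second ((((h.cons_cons hB).cons_cons (A := A) ?_)).perm ?_) hAB).symm
  · simpa [hne] using hA
  rw [List.perm_iff_count]
  intro k
  simp only [List.count_append, List.count_cons, List.count_nil]
  omega

theorem exists_forall_fst_lt (w : List (ℕ × α)) : ∃ N, ∀ k ∈ w, k.1 < N := by
  induction w with
  | nil => exact ⟨0, by simp⟩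
  | cons A w ih =>
    obtain ⟨N, hN⟩ := ih
    refine ⟨max N (A.1 + 1), fun k hk => ?_⟩
    rcases List.mem_cons.1 hk with rfl | hk
    · simp
    · exact lt_of_lt_of_le (hN k hk) (le_max_left _ _)

/-- The factor `ℕ` in the letters is there for this: new letters with any prescribed projections are
always available. -/
theorem exists_fresh (w : List (ℕ × α)) (c d : α) :
    ∃ D E : ℕ × α, D.2 = c ∧ E.2 = d ∧ D ≠ E ∧ D ∉ w ∧ E ∉ w := by
  obtain ⟨N, hN⟩ := exists_forall_fst_lt w
  refine ⟨(N, c), (N + 1, d), rfl, rfl, by simp, fun h => ?_, fun h => ?_⟩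
  · exact absurd (hN _ h) (by simp)
  · exact absurd (hN _ h) (by simp)

theorem map_swap_eq_self {K : Type u} [DecidableEq K] {x : List K} {A B : K} (hA : A ∉ x)
    (hB : B ∉ x) : x.map (Equiv.swap A B) = x :=
  (List.map_congr_left (g := id) fun _ hk => Equiv.swap_apply_of_ne_of_ne
    (ne_of_mem_of_not_mem hk hA) (ne_of_mem_of_not_mem hk hB)).trans (List.map_id _)

/-- The third move for the pattern `AB, CA, BC`. -/
theorem WordHom.third' (hτ : Function.Involutive τ) {x y z t : List (ℕ × α)} {A B C : ℕ × α}
    (h : IsDouble (x ++ [A, B] ++ y ++ [C, A] ++ z ++ [B, C] ++ t)) (hAB : B.2 = τ A.2)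
    (hAC : A.2 = C.2) :
    WordHom τ (x ++ [A, B] ++ y ++ [C, A] ++ z ++ [B, C] ++ t)
      (x ++ [B, A] ++ y ++ [A, C] ++ z ++ [C, B] ++ t) := by
  classical
  have hA := h A (by simp)
  have hB := h B (by simp)
  have hC := h C (by simp)
  have nAB : A ≠ B := by
    rintro rfl
    simp only [mult_append, mult_cons, mult_nil, if_true] at hA
    omega
  have nCB : C ≠ B := by
    rintro rfl
    simp only [mult_append, mult_cons, mult_nil, if_true] at hC
    omega
  simp only [mult_append, mult_cons, mult_nil, if_true] at hB
  have hxB : B ∉ x := mult_eq_zero_iff.1 (by omega)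
  have hyB : B ∉ y := mult_eq_zero_iff.1 (by omega)
  have hzB : B ∉ z := mult_eq_zero_iff.1 (by omega)
  have htB : B ∉ t := mult_eq_zero_iff.1 (by omega)
  -- Inserting `DE⋯ED` gives `x DEAB y CA z BCED t`. The ordinary third move, read backwards on `EA,
  -- CA, CE`, gives `x DAEB y AC z BECD t`. Now `EB⋯BE` cancels, and `D` takes over the role of `B`.
  obtain ⟨D, E, hD, hE, hDE, hDw, hEw⟩ :=
    exists_fresh (x ++ [A, B] ++ y ++ [C, A] ++ z ++ [B, C] ++ t) (τ A.2) A.2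
  have s1 := WordHom.insert_second (τ := τ) (x := x) (y := [A, B] ++ y ++ [C, A] ++ z ++ [B, C])
    (z := t) (A := D) (B := E) (by simpa using h) (by simpa using hDw) (by simpa using hEw) hDE
    (by rw [hD, hE])
  have s2 := (WordHom.third (τ := τ) (x := x ++ [D]) (y := [B] ++ y) (z := z ++ [B])
    (t := [D] ++ t) (A := A) (B := E) (C := C)
    ((by simpa using s1.isDouble_right : IsDouble
      (x ++ [D] ++ [E, A] ++ ([B] ++ y) ++ [C, A] ++ (z ++ [B]) ++ [C, E] ++ ([D] ++ t))).perm
      (perm_third _ _ _ _ _ _ _).symm) hE.symm hAC).symm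
  have s3 := WordHom.second (τ := τ) (x := x ++ [D, A]) (y := y ++ [A, C] ++ z)
    (z := [C, D] ++ t) (A := E) (B := B) (by simpa using s2.isDouble_right)
    (by rw [hE, hAB, hτ])
  have s4 : WordHom τ (x ++ [A, B] ++ y ++ [C, A] ++ z ++ [B, C] ++ t)
      (x ++ [D, A] ++ y ++ [A, C] ++ z ++ [C, D] ++ t) := by
    refine WordHom.trans (by simpa using s1) (WordHom.trans (by simpa using s2) ?_)
    simpa using s3
  have s5 := s4.replace (A := D) (B := B) (by rw [hD, hAB])
  simp only [List.mem_append, List.mem_cons, not_or] at hDw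
  have hAD : Equiv.swap D B A = A := Equiv.swap_apply_of_ne_of_ne (by tauto) nAB
  have hCD : Equiv.swap D B C = C := Equiv.swap_apply_of_ne_of_ne (by tauto) nCB
  simpa [map_swap_eq_self, hxB, hyB, hzB, htB, hAD, hCD, hDw] using s5

/-- The third move for the pattern `QP, RP, QR`. -/
theorem WordHom.third'' (hτ : Function.Involutive τ) {x y z t : List (ℕ × α)} {P Q R : ℕ × α}
    (h : IsDouble (x ++ [Q, P] ++ y ++ [R, P] ++ z ++ [Q, R] ++ t)) (hPQ : Q.2 = τ P.2)
    (hPR : R.2 = τ P.2) :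
    WordHom τ (x ++ [Q, P] ++ y ++ [R, P] ++ z ++ [Q, R] ++ t)
      (x ++ [P, Q] ++ y ++ [P, R] ++ z ++ [R, Q] ++ t) := by
  classical
  have hP := h P (by simp)
  have hQ := h Q (by simp)
  have hR := h R (by simp)
  have nPR : P ≠ R := by
    rintro rfl
    simp only [mult_append, mult_cons, mult_nil, if_true] at hP
    omega
  have nQR : Q ≠ R := by
    rintro rfl
    simp only [mult_append, mult_cons, mult_nil, if_true] at hQ
    omega
  simp only [mult_append, mult_cons, mult_nil, if_true] at hR
  have hxR : R ∉ x := mult_eq_zero_iff.1 (by omega)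
  have hyR : R ∉ y := mult_eq_zero_iff.1 (by omega)
  have hzR : R ∉ z := mult_eq_zero_iff.1 (by omega)
  have htR : R ∉ t := mult_eq_zero_iff.1 (by omega)
  -- Same device: after inserting `ST z TS`, the previous move read backwards on `QP, PS, SQ`
  -- produces `RS⋯SR`, which cancels, and `T` takes over the role of `R`.
  obtain ⟨S, T, hS, hT, hST, hSw, hTw⟩ :=
    exists_fresh (x ++ [Q, P] ++ y ++ [R, P] ++ z ++ [Q, R] ++ t) P.2 (τ P.2)
  have s1 := WordHom.insert_second (τ := τ) (x := x ++ [Q, P] ++ y ++ [R, P]) (y := z)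
    (z := [Q, R] ++ t) (A := S) (B := T) (by simpa using h) (by simpa using hSw)
    (by simpa using hTw) hST (by rw [hS, hT, hτ])
  have s2 := (WordHom.third' (τ := τ) hτ (x := x) (y := y ++ [R]) (z := [T] ++ z ++ [T])
    (t := [R] ++ t) (A := P) (B := Q) (C := S) ((by simpa using s1.isDouble_right : IsDouble
      (x ++ [Q, P] ++ (y ++ [R]) ++ [P, S] ++ ([T] ++ z ++ [T]) ++ [S, Q] ++ ([R] ++ t))).perm
      (by
        rw [List.perm_iff_count]
        intro k
        simp only [List.count_append, List.count_cons, List.count_nil]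
        omega)) hPQ hS.symm).symm
  have s3 := WordHom.second (τ := τ) (x := x ++ [P, Q] ++ y) (y := [P, T] ++ z ++ [T, Q])
    (z := t) (A := R) (B := S) (by simpa using s2.isDouble_right)
    (by rw [hS, hPR])
  have s4 : WordHom τ (x ++ [Q, P] ++ y ++ [R, P] ++ z ++ [Q, R] ++ t)
      (x ++ [P, Q] ++ y ++ [P, T] ++ z ++ [T, Q] ++ t) := by
    refine WordHom.trans (by simpa using s1) (WordHom.trans (by simpa using s2) ?_)
    simpa using s3
  have s5 := s4.replace (A := T) (B := R) (by rw [hT, hPR])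
  simp only [List.mem_append, List.mem_cons, not_or] at hTw
  have hPT : Equiv.swap T R P = P := Equiv.swap_apply_of_ne_of_ne (by tauto) nPR
  have hQT : Equiv.swap T R Q = Q := Equiv.swap_apply_of_ne_of_ne (by tauto) nQR
  simpa [map_swap_eq_self, hxR, hyR, hzR, htR, hPT, hQT, hTw] using s5

/-- The second move for the pattern `AB, AB`. -/
theorem WordHom.second' (hτ : Function.Involutive τ) {x y z : List (ℕ × α)} {A B : ℕ × α}
    (h : IsDouble (x ++ [A, B] ++ y ++ [A, B] ++ z)) (hAB : A.2 = τ B.2) :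
    WordHom τ (x ++ [A, B] ++ y ++ [A, B] ++ z) (x ++ y ++ z) := by
  classical
  -- With `CC` inserted between the second `A` and `B`, the previous move read backwards turns `AB y
  -- AC CB` into `BA y CA BC`. Then `BA⋯AB` cancels and `CC` is left.
  obtain ⟨C, -, hC, -, -, hCw, -⟩ :=
    exists_fresh (x ++ [A, B] ++ y ++ [A, B] ++ z) B.2 B.2
  have s1 := WordHom.insert_first (τ := τ) (x := x ++ [A, B] ++ y ++ [A]) (y := [B] ++ z)
    (A := C) (by simpa using h) (by simp at hCw ⊢; tauto) (by simp at hCw ⊢; tauto)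
  have s2 := (WordHom.third'' (τ := τ) hτ (x := x) (y := y) (z := []) (t := z) (P := A) (Q := B)
    (R := C) ((by simpa using s1.isDouble_right : IsDouble
      (x ++ [A, B] ++ y ++ [A, C] ++ [] ++ [C, B] ++ z)).perm
      (by
        rw [List.perm_iff_count]
        intro k
        simp only [List.count_append, List.count_cons, List.count_nil]
        omega)) (by rw [hAB, hτ]) (by rw [hC, hAB, hτ])).symm
  have s3 := WordHom.second (τ := τ) (x := x) (y := y ++ [C]) (z := [C] ++ z) (A := B) (B := A)
    (by simpa using s2.isDouble_right) (by rw [hAB, hτ])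
  have s4 := WordHom.first (τ := τ) (x := x ++ y) (y := z) (A := C)
    (by simpa using s3.isDouble_right)
  refine WordHom.trans (by simpa using s1) (WordHom.trans (by simpa using s2) ?_)
  exact WordHom.trans (by simpa using s3) (by simpa using s4)

end DerivedMoves

/-! ### States along a word and their behaviour under the moves -/

section Trajectory

variable {L : Type*} [DecidableEq L] {Q R : Type*}

/-- Reading a word from the left, a letter `A` acts on the state by `r A` at its first entry, and
by `(r A)⁻¹` at the next ones. The list `s` holds the letters that have been read before. -/
def nextState (r : L → Equiv.Perm Q) (s : List L) (A : L) (q : Q) : Q :=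
  if A ∈ s then (r A).symm q else r A q

/-- The state after reading a word. -/
def endState (r : L → Equiv.Perm Q) : List L → Q → List L → Q
  | _, q, [] => q
  | s, q, A :: w => endState r (A :: s) (nextState r s A q) w

/-- The letters of a word with the states before and after reading them. -/
def trajectory (r : L → Equiv.Perm Q) : List L → Q → List L → List (L × Q × Q)
  | _, _, [] => []
  | s, q, A :: w =>
    (A, q, nextState r s A q) :: trajectory r (A :: s) (nextState r s A q) w

theorem trajectory_append (r : L → Equiv.Perm Q) (u v : List L) : ∀ (s : List L) (q : Q),
    trajectory r s q (u ++ v) =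
      trajectory r s q u ++ trajectory r (u.reverse ++ s) (endState r s q u) v := by
  induction u with
  | nil => intro s q; rfl
  | cons A u ih => intro s q; simp [trajectory, endState, ih]

theorem nextState_congr (r : L → Equiv.Perm Q) {s s' : List L} {A : L} (h : A ∈ s ↔ A ∈ s')
    (q : Q) : nextState r s A q = nextState r s' A q := by
  simp only [nextState, h]

/-- The list of letters read so far matters only for the letters still to come, so letters deleted
or permuted by a move can be ignored in it. -/
theorem trajectory_congr (r : L → Equiv.Perm Q) {v : List L} : ∀ {s s' : List L} (q : Q),
    (∀ A ∈ v, (A ∈ s ↔ A ∈ s')) → trajectory r s q v = trajectory r s' q v := by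
  induction v with
  | nil => intros; rfl
  | cons A v ih =>
    intro s s' q h
    rw [trajectory, trajectory, nextState_congr r (h A (by simp)), ih]
    intro B hB
    simp [h B (by simp [hB])]

theorem endState_congr (r : L → Equiv.Perm Q) {v : List L} : ∀ {s s' : List L} (q : Q),
    (∀ A ∈ v, (A ∈ s ↔ A ∈ s')) → endState r s q v = endState r s' q v := by
  induction v with
  | nil => intros; rfl
  | cons A v ih =>
    intro s s' q h
    rw [endState, endState, nextState_congr r (h A (by simp)), ih]
    intro B hB
    simp [h B (by simp [hB])]

theorem trajectory_map {K : Type*} [DecidableEq K] {f : K → L} (hf : Function.Injective f)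
    (r : L → Equiv.Perm Q) (w : List K) : ∀ (s : List K) (q : Q),
    trajectory r (s.map f) q (w.map f) =
      (trajectory (r ∘ f) s q w).map (Prod.map f id) := by
  induction w with
  | nil => intros; rfl
  | cons A w ih =>
    intro s q
    have h : nextState r (s.map f) (f A) q = nextState (r ∘ f) s A q := by
      simp [nextState, hf.eq_iff]
    simp only [List.map_cons, trajectory, h, Prod.map_apply, id]
    rw [← ih, List.map_cons]

theorem filter_trajectory_eq_nil (r : L → Equiv.Perm Q) {w : List L} {D : L} (hD : D ∉ w) :
    ∀ (s : List L) (q : Q), (trajectory r s q w).filter (fun e => e.1 = D) = [] := by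
  induction w with
  | nil => intros; rfl
  | cons A w ih =>
    intro s q
    simp only [List.mem_cons, not_or] at hD
    simp [trajectory, ih hD.2, Ne.symm hD.1]

/-- The value of `m` at the state before the first entry and the state after the second one. -/
def arcValue [Zero R] (m : Q → Q → R) : List (L × Q × Q) → R
  | e :: f :: _ => m e.2.1 f.2.2
  | _ => 0

/-- The value of `m D` at the state before the first entry of `D` in `w` and the state after its
second entry. -/
def letterValue [Zero R] (r : L → Equiv.Perm Q) (m : L → Q → Q → R) (q : Q) (w : List L)
    (D : L) : R :=
  arcValue (m D) ((trajectory r [] q w).filter fun e => e.1 = D)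

variable [Zero R] (r : L → Equiv.Perm Q) (m : L → Q → Q → R) (q : Q)

theorem letterValue_map {K : Type*} [DecidableEq K] {f : K → L} (hf : Function.Injective f)
    (w : List K) (D : K) :
    letterValue r m q (w.map f) (f D) = letterValue (r ∘ f) (m ∘ f) q w D := by
  have h := trajectory_map hf r w [] q
  rw [List.map_nil] at h
  have h2 : ((fun e : L × Q × Q => decide (e.1 = f D)) ∘ (Prod.map f id : K × Q × Q → L × Q × Q)) =
      fun e => decide (e.1 = D) := by
    funext e
    simp [hf.eq_iff]
  rw [letterValue, letterValue, h, List.filter_map, h2]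
  generalize (trajectory (r ∘ f) [] q w).filter (fun e => e.1 = D) = l
  rcases l with _ | ⟨a, _ | ⟨b, l⟩⟩ <;> rfl

/-- `AA` acts trivially, so the states elsewhere do not change, and `A` starts and ends at the same
state. -/
theorem letterValue_first {x y : List L} {A : L} (hx : A ∉ x) (hy : A ∉ y) :
    (∀ D, D ≠ A → letterValue r m q (x ++ [A, A] ++ y) D = letterValue r m q (x ++ y) D) ∧
      ∃ q₁, letterValue r m q (x ++ [A, A] ++ y) A = m A q₁ q₁ := by
  have h : trajectory r [] q (x ++ [A, A] ++ y) = trajectory r [] q x ++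
      [(A, endState r [] q x, r A (endState r [] q x)),
        (A, r A (endState r [] q x), endState r [] q x)] ++
      trajectory r x.reverse (endState r [] q x) y := by
    simp only [trajectory_append, trajectory, List.append_assoc]
    simp only [endState, nextState]
    simp [hx]
    apply trajectory_congr
    intro B hB
    have : B ≠ A := ne_of_mem_of_not_mem hB hy
    simp [this]
  refine ⟨fun D hD => ?_, endState r [] q x, ?_⟩
  · rw [letterValue, letterValue, h, trajectory_append]
    simp [hD.symm]
  · rw [letterValue, h]
    simp [filter_trajectory_eq_nil, hx, hy, arcValue]

/-- `AB` and the later `BA` both act trivially. The entries of `B` lie inside those of `A`, so its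
two states are those of `A` moved by `r A`. -/
theorem letterValue_second {x y z : List L} {A B : L} (hAB : A ≠ B)
    (hA : A ∉ x ++ y ++ z) (hB : B ∉ x ++ y ++ z) (hr : r B = (r A).symm) :
    (∀ D, D ≠ A → D ≠ B → letterValue r m q (x ++ [A, B] ++ y ++ [B, A] ++ z) D =
        letterValue r m q (x ++ y ++ z) D) ∧
      ∃ q₁ q₂, letterValue r m q (x ++ [A, B] ++ y ++ [B, A] ++ z) A = m A q₁ q₂ ∧
        letterValue r m q (x ++ [A, B] ++ y ++ [B, A] ++ z) B = m B (r A q₁) (r A q₂) := by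
  simp only [List.mem_append, not_or] at hA hB
  obtain ⟨⟨hxA, hyA⟩, hzA⟩ := hA
  obtain ⟨⟨hxB, hyB⟩, hzB⟩ := hB
  let q₁ := endState r [] q x
  let q₂ := endState r x.reverse q₁ y
  have ey (s : List L) (hs : ∀ D ∈ y, (D ∈ s ↔ D ∈ x.reverse)) :
      trajectory r s q₁ y = trajectory r x.reverse q₁ y ∧ endState r s q₁ y = q₂ :=
    ⟨trajectory_congr r _ hs, endState_congr r _ hs⟩
  have ny : ∀ D ∈ y, D ≠ A ∧ D ≠ B := fun D hD =>
    ⟨ne_of_mem_of_not_mem hD hyA, ne_of_mem_of_not_mem hD hyB⟩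
  have nz : ∀ D ∈ z, D ≠ A ∧ D ≠ B := fun D hD =>
    ⟨ne_of_mem_of_not_mem hD hzA, ne_of_mem_of_not_mem hD hzB⟩
  have h : trajectory r [] q (x ++ [A, B] ++ y ++ [B, A] ++ z) = trajectory r [] q x ++
      [(A, q₁, r A q₁), (B, r A q₁, q₁)] ++ trajectory r x.reverse q₁ y ++
      [(B, q₂, r A q₂), (A, r A q₂, q₂)] ++ trajectory r (y.reverse ++ x.reverse) q₂ z := by
    have e1 := ey ([B, A] ++ x.reverse) (fun D hD => by simp [ny D hD])
    simp only [List.append_assoc, trajectory_append r x, trajectory_append r [A, B],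
      trajectory_append r y, trajectory_append r [B, A]]
    simp [trajectory, endState, nextState, hxA, hxB, hAB, hAB.symm, hr]
    have e2 : trajectory r (B :: A :: x.reverse) (endState r [] q x) y =
      trajectory r x.reverse q₁ y := e1.1
    have e3 : endState r (B :: A :: x.reverse) (endState r [] q x) y = q₂ := e1.2
    rw [e2, e3]
    simp only [q₁, true_and, List.append_cancel_left_eq]
    refine congrArg₂ _ rfl (congrArg₂ _ rfl ?_)
    apply trajectory_congr
    intro D hD
    simp [nz D hD]
  have h' : trajectory r [] q (x ++ y ++ z) = trajectory r [] q x ++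
      trajectory r x.reverse q₁ y ++ trajectory r (y.reverse ++ x.reverse) q₂ z := by
    simp only [List.append_assoc, trajectory_append r x, trajectory_append r y, List.append_nil]
    rfl
  refine ⟨fun D hDA hDB => ?_, q₁, q₂, ?_, ?_⟩
  · rw [letterValue, letterValue, h, h']
    simp [hDA.symm, hDB.symm]
  · rw [letterValue, h]
    simp [filter_trajectory_eq_nil, hxA, hyA, hzA, hAB.symm, arcValue]
  · rw [letterValue, h]
    simp [filter_trajectory_eq_nil, hxB, hyB, hzB, hAB, arcValue]

/-- With `g` the common action, the three blocks act as `g²`, `1` and `g⁻²` in either order, so the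
states elsewhere do not change. Exchanging the letters in the blocks moves both states of each of
`A`, `B`, `C` by the same power `g` or `g⁻¹`. -/
theorem letterValue_third {x y z t : List L} {A B C : L} (hAB : A ≠ B) (hAC : A ≠ C)
    (hBC : B ≠ C) (hA : A ∉ x ++ y ++ z ++ t) (hB : B ∉ x ++ y ++ z ++ t)
    (hC : C ∉ x ++ y ++ z ++ t) (hrB : r B = r A) (hrC : r C = r A) :
    (∀ D, D ≠ A → D ≠ B → D ≠ C →
      letterValue r m q (x ++ [A, B] ++ y ++ [A, C] ++ z ++ [B, C] ++ t) D =
        letterValue r m q (x ++ [B, A] ++ y ++ [C, A] ++ z ++ [C, B] ++ t) D) ∧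
      ∃ q₁ q₂ q₃,
        letterValue r m q (x ++ [A, B] ++ y ++ [A, C] ++ z ++ [B, C] ++ t) A =
          m A q₁ ((r A).symm q₂) ∧
        letterValue r m q (x ++ [A, B] ++ y ++ [A, C] ++ z ++ [B, C] ++ t) B =
          m B (r A q₁) ((r A).symm q₃) ∧
        letterValue r m q (x ++ [A, B] ++ y ++ [A, C] ++ z ++ [B, C] ++ t) C =
          m C ((r A).symm q₂) ((r A).symm ((r A).symm q₃)) ∧
        letterValue r m q (x ++ [B, A] ++ y ++ [C, A] ++ z ++ [C, B] ++ t) A =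
          m A (r A q₁) q₂ ∧
        letterValue r m q (x ++ [B, A] ++ y ++ [C, A] ++ z ++ [C, B] ++ t) B =
          m B q₁ ((r A).symm ((r A).symm q₃)) ∧
        letterValue r m q (x ++ [B, A] ++ y ++ [C, A] ++ z ++ [C, B] ++ t) C =
          m C q₂ ((r A).symm q₃) := by
  simp only [List.mem_append, not_or] at hA hB hC
  obtain ⟨⟨⟨hxA, hyA⟩, hzA⟩, htA⟩ := hA
  obtain ⟨⟨⟨hxB, hyB⟩, hzB⟩, htB⟩ := hB
  obtain ⟨⟨⟨hxC, hyC⟩, hzC⟩, htC⟩ := hC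
  let g := r A
  let q₁ := endState r [] q x
  let q₂ := endState r x.reverse (g (g q₁)) y
  let q₃ := endState r (y.reverse ++ x.reverse) q₂ z
  let q₄ := g.symm (g.symm q₃)
  have ny : ∀ D ∈ y, D ≠ A ∧ D ≠ B ∧ D ≠ C := fun D hD =>
    ⟨ne_of_mem_of_not_mem hD hyA, ne_of_mem_of_not_mem hD hyB, ne_of_mem_of_not_mem hD hyC⟩
  have nz : ∀ D ∈ z, D ≠ A ∧ D ≠ B ∧ D ≠ C := fun D hD =>
    ⟨ne_of_mem_of_not_mem hD hzA, ne_of_mem_of_not_mem hD hzB, ne_of_mem_of_not_mem hD hzC⟩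
  have nt : ∀ D ∈ t, D ≠ A ∧ D ≠ B ∧ D ≠ C := fun D hD =>
    ⟨ne_of_mem_of_not_mem hD htA, ne_of_mem_of_not_mem hD htB, ne_of_mem_of_not_mem hD htC⟩
  -- One formula serves both sides of the move: outside the blocks, only their total actions enter.
  have key : ∀ b₁ b₂ b₃ : List L, (∀ D ∈ b₁, D = A ∨ D = B ∨ D = C) →
      (∀ D ∈ b₂, D = A ∨ D = B ∨ D = C) → (∀ D ∈ b₃, D = A ∨ D = B ∨ D = C) →
      endState r x.reverse q₁ b₁ = g (g q₁) →
      endState r (y.reverse ++ (b₁.reverse ++ x.reverse)) q₂ b₂ = q₂ →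
      endState r (z.reverse ++ (b₂.reverse ++ (y.reverse ++ (b₁.reverse ++ x.reverse)))) q₃ b₃ =
        q₄ →
      trajectory r [] q (x ++ b₁ ++ y ++ b₂ ++ z ++ b₃ ++ t) =
        trajectory r [] q x ++ trajectory r x.reverse q₁ b₁ ++
        trajectory r x.reverse (g (g q₁)) y ++
        trajectory r (y.reverse ++ (b₁.reverse ++ x.reverse)) q₂ b₂ ++
        trajectory r (y.reverse ++ x.reverse) q₂ z ++
        trajectory r (z.reverse ++ (b₂.reverse ++ (y.reverse ++ (b₁.reverse ++ x.reverse)))) q₃ b₃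
        ++ trajectory r (z.reverse ++ (y.reverse ++ x.reverse)) q₄ t := by
    intro b₁ b₂ b₃ h₁ h₂ h₃ e₁ e₂ e₃
    have n (D : L) (hD : D ≠ A ∧ D ≠ B ∧ D ≠ C) : D ∉ b₁ ∧ D ∉ b₂ ∧ D ∉ b₃ :=
      ⟨fun h => by have := h₁ D h; tauto, fun h => by have := h₂ D h; tauto,
        fun h => by have := h₃ D h; tauto⟩
    have cy : ∀ D ∈ y, (D ∈ b₁.reverse ++ x.reverse ↔ D ∈ x.reverse) := fun D hD => by
      simp [n D (ny D hD)]
    have cz : ∀ D ∈ z, (D ∈ b₂.reverse ++ (y.reverse ++ (b₁.reverse ++ x.reverse)) ↔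
        D ∈ y.reverse ++ x.reverse) := fun D hD => by
      simp [n D (nz D hD)]
    have ct : ∀ D ∈ t, (D ∈ b₃.reverse ++ (z.reverse ++ (b₂.reverse ++ (y.reverse ++
        (b₁.reverse ++ x.reverse)))) ↔ D ∈ z.reverse ++ (y.reverse ++ x.reverse)) :=
      fun D hD => by simp [n D (nt D hD)]
    have f₁ : endState r [] q x = q₁ := rfl
    have f₂ : endState r (b₁.reverse ++ x.reverse) (g (g q₁)) y = q₂ := endState_congr r _ cy
    have f₃ : endState r (b₂.reverse ++ (y.reverse ++ (b₁.reverse ++ x.reverse))) q₂ z = q₃ :=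
      endState_congr r _ cz
    simp only [List.append_assoc, trajectory_append r x, trajectory_append r b₁,
      trajectory_append r y, trajectory_append r b₂, trajectory_append r z,
      trajectory_append r b₃, List.append_nil, f₁, e₁, f₂, e₂, f₃, e₃,
      trajectory_congr r _ cy, trajectory_congr r _ cz, trajectory_congr r _ ct]
  have h := key [A, B] [A, C] [B, C] (by simp) (by simp) (by simp)
    (by simp [endState, nextState, hxA, hxB, hAB.symm, hrB, g])
    (by simp [endState, nextState, hxC, hyC, hAC.symm, hBC.symm, hrC])
    (by simp [endState, nextState, hrB, hrC, g, q₄])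
  have h' := key [B, A] [C, A] [C, B] (by simp) (by simp) (by simp)
    (by simp [endState, nextState, hxA, hxB, hAB, hrB, g])
    (by simp [endState, nextState, hxC, hyC, hAC.symm, hBC.symm, hrC])
    (by simp [endState, nextState, hrB, hrC, g, q₄])
  simp only [trajectory] at h h'
  refine ⟨fun D hDA hDB hDC => ?_, q₁, q₂, q₃, ?_, ?_, ?_, ?_, ?_, ?_⟩
  · rw [letterValue, letterValue, h, h']
    simp [hDA.symm, hDB.symm, hDC.symm]
  · rw [letterValue, h]
    simp [filter_trajectory_eq_nil, hxA, hyA, hzA, htA, hAB.symm, hAC.symm, arcValue, nextState, g]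
  · rw [letterValue, h]
    simp [filter_trajectory_eq_nil, hxB, hyB, hzB, htB, hAB, hBC.symm, arcValue, nextState, g, hxA,
      hrB, hAB.symm]
  · rw [letterValue, h]
    simp [filter_trajectory_eq_nil, hxC, hyC, hzC, htC, hAC, hBC, arcValue, nextState, g, hrC, hrB]
  · rw [letterValue, h']
    simp [filter_trajectory_eq_nil, hxA, hyA, hzA, htA, hAB.symm, hAC.symm, arcValue, nextState, g,
      hxB, hrB, hrC, hxC, hyC, hBC.symm]
  · rw [letterValue, h']
    simp [filter_trajectory_eq_nil, hxB, hyB, hzB, htB, hAB, hBC.symm, arcValue, nextState, g, hrC,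
      hrB]
  · rw [letterValue, h']
    simp [filter_trajectory_eq_nil, hxC, hyC, hzC, htC, hAC, hBC, arcValue, nextState, g, hrC, hrB]

end Trajectory

/-! ### From invariance under moves on words to homotopy invariance -/

section Invariance

variable {α : Type u} {τ : α → α} {R : Type*}

/-- A function of words in `α`-alphabets that is invariant under isomorphisms and under the
homotopy moves. -/
structure IsWordInvariant (τ : α → α) (I : ∀ ⦃L : Type u⦄, (L → α) → List L → R) : Prop where
  -- Injections, not only bijections: this covers isomorphisms as well as the inclusion of the
  -- smaller alphabet left by a move.
  map : ∀ ⦃K L : Type u⦄ (f : K → L) (_ : Function.Injective f) (p : L → α) (w : List K),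
    I p (w.map f) = I (p ∘ f) w
  first : ∀ ⦃L : Type u⦄ (p : L → α) (x y : List L) (A : L), A ∉ x → A ∉ y →
    I p (x ++ [A, A] ++ y) = I p (x ++ y)
  second : ∀ ⦃L : Type u⦄ (p : L → α) (x y z : List L) (A B : L), A ≠ B → A ∉ x ++ y ++ z →
    B ∉ x ++ y ++ z → p A = τ (p B) →
    I p (x ++ [A, B] ++ y ++ [B, A] ++ z) = I p (x ++ y ++ z)
  third : ∀ ⦃L : Type u⦄ (p : L → α) (x y z t : List L) (A B C : L), A ≠ B → A ≠ C → B ≠ C →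
    A ∉ x ++ y ++ z ++ t → B ∉ x ++ y ++ z ++ t → C ∉ x ++ y ++ z ++ t → p B = p A → p C = p A →
    I p (x ++ [A, B] ++ y ++ [A, C] ++ z ++ [B, C] ++ t) =
      I p (x ++ [B, A] ++ y ++ [C, A] ++ z ++ [C, B] ++ t)

theorem not_mem_incl {L : Type u} {s : Set L} {A : L} (hA : A ∈ s) (x : List (Without L s)) :
    A ∉ incl x := fun h => by
  obtain ⟨D, -, rfl⟩ := List.mem_map.1 h
  exact D.2 hA

namespace IsWordInvariant

variable {I : ∀ ⦃L : Type u⦄, (L → α) → List L → R}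

theorem eq_of_move (hI : IsWordInvariant τ I) {U V : Nanoword α}
    (h : HomotopyMove τ (diagonal α) U V) :
    I U.proj U.word = I V.proj V.word := by
  classical
  cases h with
  | first L p A x y hU hV =>
    have e := hI.map Subtype.val Subtype.val_injective p (x ++ y)
    refine (hI.first p (incl x) (incl y) A (not_mem_incl (Set.mem_singleton A) x)
      (not_mem_incl (Set.mem_singleton A) y)).trans ?_
    rw [incl, incl, ← List.map_append]
    exact e
  | second L p A B hAB x y z hU hV =>
    have hA := hU A
    have hne : A ≠ B := by
      rintro rfl
      simp only [mult_append, mult_cons, mult_nil, if_true] at hA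
      omega
    have e := hI.map Subtype.val Subtype.val_injective p (x ++ y ++ z)
    have e' : incl x ++ incl y ++ incl z = (x ++ y ++ z).map Subtype.val := by
      simp only [List.map_append, incl]
    refine (hI.second p _ _ _ A B hne ?_ ?_ hAB).trans ?_
    · simp [not_mem_incl]
    · simp [not_mem_incl]
    · rw [e']
      exact e
  | third L p A B C hABC x y z t hU hV =>
    have hA := hU A
    have hB := hU B
    have hAB : A ≠ B := by
      rintro rfl
      simp only [mult_append, mult_cons, mult_nil, if_true] at hA
      omega
    have hAC : A ≠ C := by
      rintro rfl
      simp only [mult_append, mult_cons, mult_nil, if_true] at hA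
      omega
    have hBC : B ≠ C := by
      rintro rfl
      simp only [mult_append, mult_cons, mult_nil, if_true] at hB
      omega
    obtain ⟨a, ha⟩ := hABC
    simp only [Prod.mk.injEq] at ha
    obtain ⟨h1, h2, h3⟩ := ha
    refine hI.third p _ _ _ _ A B C hAB hAC hBC ?_ ?_ ?_ (h2.trans h1.symm) (h3.trans h1.symm) <;>
      simp [not_mem_incl]

theorem eq_of_homotopic (hI : IsWordInvariant τ I) {U V : Nanoword α}
    (h : U.Homotopic τ (diagonal α) V) :
    I U.proj U.word = I V.proj V.word := by
  induction h with
  | rel U V h =>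
    rcases h with ⟨f, hf, hw⟩ | h
    · rw [hw, hI.map f f.injective]
      congr 1
      exact (funext hf).symm
    · exact hI.eq_of_move h
  | refl => rfl
  | symm _ _ _ ih => exact ih.symm
  | trans _ _ _ _ _ ih ih' => exact ih.trans ih'

theorem eq_of_spells (hI : IsWordInvariant τ I) {U : Nanoword α} {w : List (ℕ × α)}
    (h : Spells U w) :
    I U.proj U.word = I Prod.snd w := by
  obtain ⟨f, hf, hp, rfl⟩ := h
  rw [hI.map f hf]
  congr 1
  exact (funext hp).symm

end IsWordInvariant

end Invariance

/-! ### The invariants that sum over letters -/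

section LetterSum

variable {L : Type*} [DecidableEq L] {Q R : Type*} [AddCommGroup R]

/-- The sum of the values of the letters of a word. -/
def letterSum (r : L → Equiv.Perm Q) (m : L → Q → Q → R) (q : Q) (w : List L) : R :=
  ∑ D ∈ w.toFinset, letterValue r m q w D

theorem toFinset_map_of_injective {K : Type*} [DecidableEq K] (f : K → L) (w : List K) :
    (w.map f).toFinset = w.toFinset.image f := by
  ext; simp

theorem letterSum_map {K : Type*} [DecidableEq K] {f : K → L} (hf : Function.Injective f)
    (r : L → Equiv.Perm Q) (m : L → Q → Q → R) (q : Q) (w : List K) :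
    letterSum r m q (w.map f) = letterSum (r ∘ f) (m ∘ f) q w := by
  rw [letterSum, toFinset_map_of_injective, Finset.sum_image hf.injOn]
  exact Finset.sum_congr rfl fun D _ => letterValue_map r m q hf w D

theorem toFinset_first (x y : List L) (A : L) :
    (x ++ [A, A] ++ y).toFinset = insert A (x ++ y).toFinset := by
  ext; simp

theorem toFinset_second (x y z : List L) (A B : L) :
    (x ++ [A, B] ++ y ++ [B, A] ++ z).toFinset = insert A (insert B (x ++ y ++ z).toFinset) := by
  ext; simp; tauto

theorem toFinset_third (x y z t : List L) (A B C : L) :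
    (x ++ [A, B] ++ y ++ [A, C] ++ z ++ [B, C] ++ t).toFinset =
      (x ++ [B, A] ++ y ++ [C, A] ++ z ++ [C, B] ++ t).toFinset := by
  ext; simp; tauto

end LetterSum

section LetterSumInvariant

variable {α : Type u} {τ : α → α} {Q R : Type*} [AddCommGroup R]

-- Each hypothesis on `μ` answers a move. A letter removed by the first move contributes zero by
-- `h_diag`. For the second, `h_shift` brings the states of `B` to those of `A`, and `h_inv` cancels
-- the two terms. For the third, `h_shift` makes the value of each letter unchanged.
open scoped Classical in
theorem isWordInvariant_letterSum {ρ : α → Equiv.Perm Q} {μ : α → Q → Q → R}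
    (hρ : ∀ a, ρ (τ a) = (ρ a).symm) (h_diag : ∀ a s, μ a s s = 0)
    (h_shift : ∀ a s t, μ a (ρ a s) (ρ a t) = μ a s t)
    (h_inv : ∀ a s t, μ (τ a) s t + μ a s t = 0) (q : Q) :
    IsWordInvariant τ fun _ p w => letterSum (ρ ∘ p) (μ ∘ p) q w where
  map K L f hf p w := by
    rw [letterSum_map hf]
    rfl
  first L p x y A hx hy := by
    obtain ⟨h, q₁, h₁⟩ := letterValue_first (ρ ∘ p) (μ ∘ p) q hx hy
    have hA : A ∉ (x ++ y).toFinset := by simp [hx, hy]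
    rw [letterSum, toFinset_first, Finset.sum_insert hA, h₁, Function.comp_apply, h_diag, zero_add]
    exact Finset.sum_congr rfl fun D hD => h D (ne_of_mem_of_not_mem hD hA)
  second L p x y z A B hAB hA hB hp := by
    obtain ⟨h, q₁, q₂, h₁, h₂⟩ := letterValue_second (ρ ∘ p) (μ ∘ p) q hAB hA hB (by
      simp [hp, hρ])
    have hA' : A ∉ insert B (x ++ y ++ z).toFinset := by
      simpa [hAB] using hA
    have hB' : B ∉ (x ++ y ++ z).toFinset := by simpa using hB
    have e := h_shift (p B) ((ρ (p B)).symm q₁) ((ρ (p B)).symm q₂)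
    simp only [Equiv.apply_symm_apply] at e
    rw [letterSum, toFinset_second, Finset.sum_insert hA', Finset.sum_insert hB', h₁, h₂,
      ← add_assoc]
    simp only [Function.comp_apply, hp, hρ]
    rw [← e, h_inv, zero_add]
    refine Finset.sum_congr rfl fun D hD => h D ?_ ?_
    · exact ne_of_mem_of_not_mem (Finset.mem_insert_of_mem hD) hA'
    · exact ne_of_mem_of_not_mem hD hB'
  third L p x y z t A B C hAB hAC hBC hA hB hC hpB hpC := by
    obtain ⟨h, q₁, q₂, q₃, h₁, h₂, h₃, h₄, h₅, h₆⟩ := letterValue_third (ρ ∘ p) (μ ∘ p) q hAB hAC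
      hBC hA hB hC (by simp [hpB]) (by simp [hpC])
    rw [letterSum, letterSum, toFinset_third]
    refine Finset.sum_congr rfl fun D _ => ?_
    have e (s t : Q) : μ (p A) ((ρ (p A)).symm s) ((ρ (p A)).symm t) = μ (p A) s t := by
      simpa using (h_shift (p A) ((ρ (p A)).symm s) ((ρ (p A)).symm t)).symm
    simp only [Function.comp_apply, hpB, hpC] at h₁ h₂ h₃ h₄ h₅ h₆
    by_cases hDA : D = A
    · rw [hDA, h₁, h₄, ← h_shift, Equiv.apply_symm_apply]
    by_cases hDB : D = B
    · rw [hDB, h₂, h₅, ← e, Equiv.symm_apply_apply]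
    by_cases hDC : D = C
    · rw [hDC, h₃, h₆, e]
    exact h D hDA hDB hDC

end LetterSumInvariant

/-! ### The secondary invariant, counting pairs of letters modulo two -/

section PairSum

variable {L : Type*} [DecidableEq L] {G : Type*} [AddCommGroup G]

/-- The entries of `X` and `Y` in a word, with `true` for `Y` and `false` for the others. -/
def pattern (X Y : L) (w : List L) : List Bool :=
  (w.filter fun D => D = X ∨ D = Y).map fun D => D = Y

/-- Two consecutive entries are `true`. -/
def HasRepeat (l : List Bool) : Prop := [true, true] <:+: l

instance (l : List Bool) : Decidable (HasRepeat l) :=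
  inferInstanceAs (Decidable ([true, true] <:+: l))

/-- The sum of the labels along `w` from the first entry of `D` to the second one, both included,
where a letter counts with the opposite sign at its second entry. -/
def displacement (e : L → G) (w : List L) (D : L) : G :=
  letterValue (fun D => Equiv.addRight (e D)) (fun _ s t => t - s) 0 w D

theorem pattern_append (X Y : L) (u v : List L) :
    pattern X Y (u ++ v) = pattern X Y u ++ pattern X Y v := by
  simp [pattern]

theorem pattern_eq_nil {X Y : L} {w : List L} (hX : X ∉ w) (hY : Y ∉ w) :
    pattern X Y w = [] := by
  have : ∀ D ∈ w, ¬ (D = X ∨ D = Y) := fun D hD h => by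
    rcases h with rfl | rfl <;> contradiction
  simpa [pattern] using this

theorem pattern_congr_left {X X' Y : L} {w : List L} (hX : X ∉ w) (hX' : X' ∉ w) :
    pattern X Y w = pattern X' Y w := by
  rw [pattern, pattern, List.filter_congr]
  intro D hD
  simp [ne_of_mem_of_not_mem hD hX, ne_of_mem_of_not_mem hD hX']

theorem pattern_congr_right {X Y Y' : L} {w : List L} (hY : Y ∉ w) (hY' : Y' ∉ w) :
    pattern X Y w = pattern X Y' w := by
  have h : w.filter (fun D => D = X ∨ D = Y) = w.filter (fun D => D = X ∨ D = Y') := by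
    rw [List.filter_congr]
    intro D hD
    simp [ne_of_mem_of_not_mem hD hY, ne_of_mem_of_not_mem hD hY']
  rw [pattern, pattern, h]
  refine List.map_congr_left fun D hD => ?_
  have hD := (List.mem_filter.1 hD).1
  simp [ne_of_mem_of_not_mem hD hY, ne_of_mem_of_not_mem hD hY']

theorem pattern_map {K : Type*} [DecidableEq K] {f : K → L} (hf : Function.Injective f) (X Y : K)
    (w : List K) : pattern (f X) (f Y) (w.map f) = pattern X Y w := by
  simp [pattern, List.filter_map, Function.comp_def, hf.eq_iff]

theorem displacement_map {K : Type*} [DecidableEq K] {f : K → L} (hf : Function.Injective f)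
    (e : L → G) (w : List K) (D : K) :
    displacement e (w.map f) (f D) = displacement (e ∘ f) w D :=
  letterValue_map _ _ _ hf w D

variable [DecidableEq G]

/-- Whether `X` has displacement `g`, `Y` has displacement zero, and `X` has an entry between the
two entries of `Y`. -/
def pairValue (e : L → G) (g : G) (w : List L) (X Y : L) : ZMod 2 :=
  if displacement e w X = g ∧ displacement e w Y = 0 ∧ ¬ HasRepeat (pattern X Y w) then 1 else 0

/-- The number modulo two of pairs of a letter of displacement `g` and a letter of displacement
zero such that the former has an entry between the two entries of the latter. -/
def pairSum (e : L → G) (g : G) (w : List L) : ZMod 2 :=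
  ∑ X ∈ w.toFinset, ∑ Y ∈ w.toFinset, pairValue e g w X Y

theorem pairSum_map {K : Type*} [DecidableEq K] {f : K → L} (hf : Function.Injective f)
    (e : L → G) (g : G) (w : List K) : pairSum e g (w.map f) = pairSum (e ∘ f) g w := by
  simp only [pairSum, toFinset_map_of_injective, Finset.sum_image hf.injOn, pairValue,
    displacement_map hf, pattern_map hf]

theorem pairValue_eq_zero_left {e : L → G} {g : G} {w : List L} {X : L} (Y : L)
    (h : displacement e w X ≠ g) : pairValue e g w X Y = 0 :=
  if_neg fun h' => h h'.1

theorem pairValue_eq_zero_of_hasRepeat {e : L → G} {g : G} {w : List L} {X Y : L}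
    (h : HasRepeat (pattern X Y w)) : pairValue e g w X Y = 0 :=
  if_neg fun h' => h'.2.2 h

theorem pairValue_eq_zero_of_eq {e : L → G} {g : G} (hg : g ≠ 0) {w : List L} {X Y : L}
    (h : displacement e w X = displacement e w Y) : pairValue e g w X Y = 0 :=
  if_neg fun h' => hg (by rw [← h'.1, h, h'.2.1])

theorem hasRepeat_append (u v : List Bool) : HasRepeat (u ++ [true, true] ++ v) :=
  ⟨u, v, rfl⟩

theorem pairValue_congr {e : L → G} {g : G} {w w' : List L} {X X' Y Y' : L}
    (hX : displacement e w X = displacement e w' X')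
    (hY : displacement e w Y = displacement e w' Y') (h : pattern X Y w = pattern X' Y' w') :
    pairValue e g w X Y = pairValue e g w' X' Y' := by
  rw [pairValue, pairValue, hX, hY, h]

/-- The letter `A` has displacement zero, so it is never the first member of a pair as `g ≠ 0`;
nothing enters between its two entries, so it is never the second. -/
theorem pairSum_first (e : L → G) {g : G} (hg : g ≠ 0) {x y : List L} {A : L} (hx : A ∉ x)
    (hy : A ∉ y) : pairSum e g (x ++ [A, A] ++ y) = pairSum e g (x ++ y) := by
  obtain ⟨h, q₁, h₁⟩ := letterValue_first (fun D => Equiv.addRight (e D)) (fun _ s t => t - s) 0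
    hx hy
  have hA : A ∉ (x ++ y).toFinset := by simp [hx, hy]
  have hA0 : displacement e (x ++ [A, A] ++ y) A = 0 := h₁.trans (sub_self _)
  rw [pairSum, toFinset_first, Finset.sum_insert hA, Finset.sum_eq_zero fun Y _ =>
    pairValue_eq_zero_left Y (by rw [hA0]; exact hg.symm), zero_add]
  refine Finset.sum_congr rfl fun X hX => ?_
  have nX := ne_of_mem_of_not_mem hX hA
  rw [Finset.sum_insert hA, pairValue_eq_zero_of_hasRepeat, zero_add]
  · refine Finset.sum_congr rfl fun Y hY => ?_
    have nY := ne_of_mem_of_not_mem hY hA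
    refine pairValue_congr (h X nX) (h Y nY) ?_
    rw [pattern_append, pattern_append, pattern_append, pattern_eq_nil (w := [A, A]),
      List.append_nil] <;> simp [nX, nY]
  · rw [pattern_append, pattern_append]
    have : pattern X A [A, A] = [true, true] := by simp [pattern]
    rw [this]
    exact hasRepeat_append _ _

/-- The rows of `A` and `B` agree, and so do their columns, so they cancel modulo two. -/
theorem sum_insert_insert_eq {S : Finset L} {A B : L} {f f' : L → L → ZMod 2}
    (hA : A ∉ insert B S) (hB : B ∉ S) (hAA : f A A = 0) (hAB : f A B = 0) (hBA : f B A = 0)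
    (hBB : f B B = 0) (h₁ : ∀ Y ∈ S, f A Y = f B Y) (h₂ : ∀ X ∈ S, f X A = f X B)
    (h : ∀ X ∈ S, ∀ Y ∈ S, f X Y = f' X Y) :
    ∑ X ∈ insert A (insert B S), ∑ Y ∈ insert A (insert B S), f X Y =
      ∑ X ∈ S, ∑ Y ∈ S, f' X Y := by
  simp only [Finset.sum_insert hA, Finset.sum_insert hB, hAA, hAB, hBA, hBB, zero_add]
  rw [Finset.sum_congr rfl h₁, ← add_assoc, CharTwo.add_self_eq_zero, zero_add]
  refine Finset.sum_congr rfl fun X hX => ?_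
  rw [h₂ X hX, ← add_assoc, CharTwo.add_self_eq_zero, zero_add]
  exact Finset.sum_congr rfl (h X hX)

/-- `A` and `B` are neighbours at both places, so they have the same displacement and the same
position relative to any other letter, and their pairs cancel. Pairs among `A` and `B` themselves do
not count, since `g ≠ 0`. -/
theorem pairSum_second {e : L → G} {g : G} (hg : g ≠ 0) {x y z : List L} {A B : L} (hAB : A ≠ B)
    (hA : A ∉ x ++ y ++ z) (hB : B ∉ x ++ y ++ z) (he : e B = - e A) :
    pairSum e g (x ++ [A, B] ++ y ++ [B, A] ++ z) = pairSum e g (x ++ y ++ z) := by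
  obtain ⟨h, q₁, q₂, h₁, h₂⟩ := letterValue_second (fun D => Equiv.addRight (e D))
    (fun _ s t => t - s) 0 hAB hA hB (by ext; simp [he])
  have hA' : A ∉ insert B (x ++ y ++ z).toFinset := by simpa [hAB] using hA
  have hB' : B ∉ (x ++ y ++ z).toFinset := by simpa using hB
  have hd : displacement e (x ++ [A, B] ++ y ++ [B, A] ++ z) A =
      displacement e (x ++ [A, B] ++ y ++ [B, A] ++ z) B := by
    refine h₁.trans (Eq.trans ?_ h₂.symm)
    simp
  have n (D : L) (hD : D ∈ (x ++ y ++ z).toFinset) : D ≠ A ∧ D ≠ B :=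
    ⟨ne_of_mem_of_not_mem (Finset.mem_insert_of_mem hD) hA', ne_of_mem_of_not_mem hD hB'⟩
  simp only [List.mem_append, not_or] at hA hB
  rw [pairSum, toFinset_second]
  refine sum_insert_insert_eq hA' hB' (pairValue_eq_zero_of_eq hg rfl)
    (pairValue_eq_zero_of_eq hg hd) (pairValue_eq_zero_of_eq hg hd.symm)
    (pairValue_eq_zero_of_eq hg rfl) (fun Y hY => ?_) (fun X hX => ?_) fun X hX Y hY => ?_
  · refine pairValue_congr hd rfl ?_
    have hY := n Y hY
    simp only [pattern_append]
    rw [pattern_congr_left hA.1.1 hB.1.1, pattern_congr_left hA.1.2 hB.1.2,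
      pattern_congr_left hA.2 hB.2]
    simp [pattern, hAB, hAB.symm, hY.1.symm, hY.2.symm]
  · refine pairValue_congr rfl hd ?_
    have hX := n X hX
    simp only [pattern_append]
    rw [pattern_congr_right hA.1.1 hB.1.1, pattern_congr_right hA.1.2 hB.1.2,
      pattern_congr_right hA.2 hB.2]
    simp [pattern, hAB, hAB.symm, hX.1.symm, hX.2.symm]
  · obtain ⟨hXA, hXB⟩ := n X hX
    obtain ⟨hYA, hYB⟩ := n Y hY
    refine pairValue_congr (h X hXA hXB) (h Y hYA hYB) ?_
    simp only [pattern_append]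
    simp [pattern, hXA.symm, hXB.symm, hYA.symm, hYB.symm]

theorem sum_sum_eq_of_subset {S T : Finset L} (hT : T ⊆ S) {f f' : L → L → ZMod 2}
    (h : ∀ X Y, X ∉ T ∨ Y ∉ T → f X Y = f' X Y)
    (hTT : ∑ X ∈ T, ∑ Y ∈ T, f X Y = ∑ X ∈ T, ∑ Y ∈ T, f' X Y) :
    ∑ X ∈ S, ∑ Y ∈ S, f X Y = ∑ X ∈ S, ∑ Y ∈ S, f' X Y := by
  have e (k : L → L → ZMod 2) : ∑ X ∈ S, ∑ Y ∈ S, k X Y = ∑ X ∈ S \ T, ∑ Y ∈ S, k X Y +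
      (∑ X ∈ T, ∑ Y ∈ S \ T, k X Y + ∑ X ∈ T, ∑ Y ∈ T, k X Y) := by
    rw [← Finset.sum_sdiff hT, ← Finset.sum_add_distrib]
    simp_rw [← Finset.sum_sdiff hT (f := k _)]
  rw [e f, e f', hTT]
  congr 1
  · exact Finset.sum_congr rfl fun X hX => Finset.sum_congr rfl fun Y _ =>
      h X Y (.inl (Finset.mem_sdiff.1 hX).2)
  · congr 1
    exact Finset.sum_congr rfl fun X _ => Finset.sum_congr rfl fun Y hY =>
      h X Y (.inr (Finset.mem_sdiff.1 hY).2)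

theorem pattern_comm_pair {X Y A B : L} (h : X ≠ A ∧ Y ≠ A ∨ X ≠ B ∧ Y ≠ B) :
    pattern X Y [A, B] = pattern X Y [B, A] := by
  rcases h with h | h <;> simp [pattern, List.filter_cons, h.1.symm, h.2.symm]

-- The move preserves all displacements and can change relative positions only within `{A, B, C}`.
-- There `(B, A)` and `(B, C)` may count only before the move, and `(A, C)` and `(C, A)` only after
-- it. The relation that the displacement of `B` is the sum of those of `A` and `C` balances these.
set_option linter.unusedSimpArgs false in
theorem pairSum_third {e : L → G} {g : G} (hg : g ≠ 0) {x y z t : List L} {A B C : L}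
    (hAB : A ≠ B) (hAC : A ≠ C) (hBC : B ≠ C) (hA : A ∉ x ++ y ++ z ++ t)
    (hB : B ∉ x ++ y ++ z ++ t) (hC : C ∉ x ++ y ++ z ++ t) (heB : e B = e A) (heC : e C = e A) :
    pairSum e g (x ++ [A, B] ++ y ++ [A, C] ++ z ++ [B, C] ++ t) =
      pairSum e g (x ++ [B, A] ++ y ++ [C, A] ++ z ++ [C, B] ++ t) := by
  obtain ⟨h, q₁, q₂, q₃, h₁, h₂, h₃, h₄, h₅, h₆⟩ := letterValue_third
    (fun D => Equiv.addRight (e D)) (fun _ s t => t - s) 0 hAB hAC hBC hA hB hC (by simp [heB])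
    (by simp [heC])
  simp only [Equiv.coe_addRight, Equiv.addRight_symm] at h₁ h₂ h₃ h₄ h₅ h₆
  rw [pairSum, pairSum, toFinset_third]
  simp only [← displacement.eq_def] at h h₁ h₂ h₃ h₄ h₅ h₆
  set w := x ++ [A, B] ++ y ++ [A, C] ++ z ++ [B, C] ++ t with hw
  set w' := x ++ [B, A] ++ y ++ [C, A] ++ z ++ [C, B] ++ t with hw'
  have dA : displacement e w' A = displacement e w A := by rw [h₁, h₄]; abel
  have dB : displacement e w' B = displacement e w B := by rw [h₂, h₅]; abel
  have dC : displacement e w' C = displacement e w C := by rw [h₃, h₆]; abel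
  have dBAC : displacement e w B = displacement e w A + displacement e w C := by
    rw [h₁, h₂, h₃]; abel
  have d (D : L) : displacement e w' D = displacement e w D := by
    by_cases hDA : D = A
    · rw [hDA, dA]
    by_cases hDB : D = B
    · rw [hDB, dB]
    by_cases hDC : D = C
    · rw [hDC, dC]
    exact (h D hDA hDB hDC).symm
  refine sum_sum_eq_of_subset (T := {A, B, C}) ?_ (fun X Y hXY => ?_) ?_
  · simp [Finset.subset_iff, hw']
  · refine pairValue_congr (d X).symm (d Y).symm ?_
    simp only [hw, hw', pattern_append]
    simp only [Finset.mem_insert, Finset.mem_singleton, not_or] at hXY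
    rw [pattern_comm_pair (A := A) (B := B), pattern_comm_pair (A := A) (B := C),
      pattern_comm_pair (A := B) (B := C)]
    all_goals grind
  · simp only [List.mem_append, not_or] at hA hB hC
    have n (X : L) (hX : X = A ∨ X = B ∨ X = C) : X ∉ x ∧ X ∉ y ∧ X ∉ z ∧ X ∉ t := by
      rcases hX with rfl | rfl | rfl <;> tauto
    have p (X Y : L) (hX : X = A ∨ X = B ∨ X = C) (hY : Y = A ∨ Y = B ∨ Y = C) :
        pattern X Y w = pattern X Y [A, B] ++ pattern X Y [A, C] ++ pattern X Y [B, C] ∧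
        pattern X Y w' = pattern X Y [B, A] ++ pattern X Y [C, A] ++ pattern X Y [C, B] := by
      have nX := n X hX
      have nY := n Y hY
      simp only [hw, hw', pattern_append, pattern_eq_nil nX.1 nY.1, pattern_eq_nil nX.2.1 nY.2.1,
        pattern_eq_nil nX.2.2.1 nY.2.2.1, pattern_eq_nil nX.2.2.2 nY.2.2.2, List.nil_append,
        List.append_nil, and_self]
    have v (X Y : L) (u : List L) (b : List Bool) (hb : pattern X Y u = b) :
        pairValue e g u X Y =
          if displacement e u X = g ∧ displacement e u Y = 0 ∧ ¬ HasRepeat b then 1 else 0 := by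
      rw [pairValue, hb]
    have hAB' := hAB.symm
    have hAC' := hAC.symm
    have hBC' := hBC.symm
    have q (X Y : L) (hX : X = A ∨ X = B ∨ X = C) (hY : Y = A ∨ Y = B ∨ Y = C) (b b' : List Bool)
        (hb : pattern X Y [A, B] ++ pattern X Y [A, C] ++ pattern X Y [B, C] = b)
        (hb' : pattern X Y [B, A] ++ pattern X Y [C, A] ++ pattern X Y [C, B] = b') :
        pattern X Y w = b ∧ pattern X Y w' = b' :=
      ⟨(p X Y hX hY).1.trans hb, (p X Y hX hY).2.trans hb'⟩
    have eAB := q A B (by simp) (by simp) [false, true, false, true]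
      [true, false, false, true]
      (by simp [pattern, hAB, hAC, hBC, hAB', hAC', hBC'])
      (by simp [pattern, hAB, hAC, hBC, hAB', hAC', hBC'])
    have eBA := q B A (by simp) (by simp) [true, false, true, false]
      [false, true, true, false]
      (by simp [pattern, hAB, hAC, hBC, hAB', hAC', hBC'])
      (by simp [pattern, hAB, hAC, hBC, hAB', hAC', hBC'])
    have eAC := q A C (by simp) (by simp) [false, false, true, true]
      [false, true, false, true]
      (by simp [pattern, hAB, hAC, hBC, hAB', hAC', hBC'])
      (by simp [pattern, hAB, hAC, hBC, hAB', hAC', hBC'])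
    have eCA := q C A (by simp) (by simp) [true, true, false, false]
      [true, false, true, false]
      (by simp [pattern, hAB, hAC, hBC, hAB', hAC', hBC'])
      (by simp [pattern, hAB, hAC, hBC, hAB', hAC', hBC'])
    have eBC := q B C (by simp) (by simp) [false, true, false, true]
      [false, true, true, false]
      (by simp [pattern, hAB, hAC, hBC, hAB', hAC', hBC'])
      (by simp [pattern, hAB, hAC, hBC, hAB', hAC', hBC'])
    have eCB := q C B (by simp) (by simp) [true, false, true, false]
      [true, false, false, true]
      (by simp [pattern, hAB, hAC, hBC, hAB', hAC', hBC'])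
      (by simp [pattern, hAB, hAC, hBC, hAB', hAC', hBC'])
    have hABC : A ∉ ({B, C} : Finset L) := by simp [hAB, hAC]
    have hBC'' : B ∉ ({C} : Finset L) := by simp [hBC]
    simp only [Finset.sum_insert hABC, Finset.sum_insert hBC'', Finset.sum_singleton,
      pairValue_eq_zero_of_eq hg (rfl : displacement e _ _ = _)]
    rw [v A B w _ eAB.1, v A B w' _ eAB.2, v B A w _ eBA.1, v B A w' _ eBA.2, v A C w _ eAC.1,
      v A C w' _ eAC.2, v C A w _ eCA.1, v C A w' _ eCA.2, v B C w _ eBC.1, v B C w' _ eBC.2,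
      v C B w _ eCB.1, v C B w' _ eCB.2, dA, dB, dC, dBAC]
    have r₁ : ¬ HasRepeat [false, true, false, true] := by decide
    have r₂ : ¬ HasRepeat [true, false, true, false] := by decide
    have r₃ : HasRepeat [false, false, true, true] := by decide
    have r₄ : HasRepeat [true, true, false, false] := by decide
    have r₅ : ¬ HasRepeat [true, false, false, true] := by decide
    have r₆ : HasRepeat [false, true, true, false] := by decide
    simp only [r₁, r₂, r₃, r₄, r₅, r₆, not_true, not_false_iff, and_true, and_false, if_false]
    -- If `A` has displacement zero, `B` and `C` have equal ones and `(C, A)` replaces `(B, A)`; if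
    -- `C` does, `(A, C)` replaces `(B, C)`.
    by_cases hA0 : displacement e w A = 0
    · by_cases hC0 : displacement e w C = 0
      · simp [hA0, hC0, hg.symm]
      · simp [hA0, hC0, hg.symm]
    · by_cases hC0 : displacement e w C = 0
      · simp [hA0, hC0, hg.symm, add_comm]
      · simp [hA0, hC0, hg.symm]

end PairSum

section PairSumInvariant

variable {α : Type u} {τ : α → α} {G : Type*} [AddCommGroup G] [DecidableEq G]

open scoped Classical in
theorem isWordInvariant_pairSum {ε : α → G} (hε : ∀ a, ε (τ a) = - ε a) {g : G} (hg : g ≠ 0) :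
    IsWordInvariant τ fun _ p w => pairSum (ε ∘ p) g w where
  map K L f hf p w := pairSum_map hf _ _ _
  first L p x y A hx hy := pairSum_first _ hg hx hy
  second L p x y z A B hAB hA hB hp := pairSum_second hg hAB hA hB (by simp [hp, hε])
  third L p x y z t A B C hAB hAC hBC hA hB hC hpB hpC :=
    pairSum_third hg hAB hAC hBC hA hB hC (by simp [hpB]) (by simp [hpC])

end PairSumInvariant

/-! ### The words of the theorem and the explicit homotopies -/

section Desingularizes

variable {α : Type u} {τ : α → α} {a b : α}

theorem spells_desing (w : List α) :
    Spells (EtaleWord.ofWord w).desing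
      ((rawDesing w).map fun t => (Nat.pair t.2.1 t.2.2, t.1)) := by
  refine ⟨fun t => (Nat.pair t.1.2.1 t.1.2.2, t.1.1), fun s t h => ?_, fun _ => rfl, ?_⟩
  · have h₁ := Nat.pair_eq_pair.1 (congrArg Prod.fst h)
    have h₂ := congrArg Prod.snd h
    exact Subtype.ext (Prod.ext h₂ (Prod.ext h₁.1 h₁.2))
  · have h : (desingWord w).map Subtype.val = rawDesing w := List.attachWith_map_subtype_val _
    change (desingWord w).map _ = _
    rw [← h, List.map_map]
    rfl

theorem spells_empty : Spells (Nanoword.empty α) [] :=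
  ⟨PEmpty.elim, fun A => A.elim, fun A => A.elim, rfl⟩

/-- The letters `a_{1,2}`, `a_{1,3}`, `a_{2,3}`, `b_{1,2}`. -/
def desingLetter (a b : α) : Fin 4 → ℕ × α :=
  -- The values of `Nat.pair` at `(1, 2)`, `(1, 3)`, `(2, 3)` and again `(1, 2)`.
  ![(5, a), (10, a), (11, a), (5, b)]

theorem desingLetter_injective (hab : a ≠ b) : Function.Injective (desingLetter a b) := by
  intro i j h
  fin_cases i <;> fin_cases j <;> simp_all [desingLetter]

/-- The word `w` on `α` desingularizes to the word `W`, written in the letters `0 = a_{1,2}`,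
`1 = a_{1,3}`, `2 = a_{2,3}`, `3 = b_{1,2}`. -/
def Desingularizes (a b : α) (w : List α) (W : List (Fin 4)) : Prop :=
  Spells (EtaleWord.ofWord w).desing (W.map (desingLetter a b))

theorem Desingularizes.of_eq {w : List α} {W : List (Fin 4)}
    (h : (rawDesing w).map (fun t => (Nat.pair t.2.1 t.2.2, t.1)) = W.map (desingLetter a b)) :
    Desingularizes a b w W := by
  rw [Desingularizes, ← h]
  exact spells_desing w

/-- Homotopy of words in the letters `a_{1,2}`, `a_{1,3}`, `a_{2,3}`, `b_{1,2}`. -/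
def DesingHom (τ : α → α) (a b : α) (V W : List (Fin 4)) : Prop :=
  WordHom τ (V.map (desingLetter a b)) (W.map (desingLetter a b))

theorem DesingHom.symm {V W : List (Fin 4)} (h : DesingHom τ a b V W) : DesingHom τ a b W V :=
  WordHom.symm h

theorem DesingHom.trans {V W X : List (Fin 4)} (h : DesingHom τ a b V W)
    (h' : DesingHom τ a b W X) : DesingHom τ a b V X :=
  WordHom.trans h h'

theorem Desingularizes.homotopic_iff {v w : List α} {V W : List (Fin 4)}
    (hv : Desingularizes a b v V) (hw : Desingularizes a b w W) :
    Homotopic τ v w ↔ DesingHom τ a b V W :=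
  ⟨fun h => ⟨_, _, hv, hw, h⟩, fun h => h.homotopic hv hw⟩

theorem Desingularizes.contractible_iff {v : List α} {V : List (Fin 4)}
    (hv : Desingularizes a b v V) : Contractible τ v ↔ DesingHom τ a b V [] :=
  ⟨fun h => ⟨_, _, hv, spells_empty, h⟩, fun h => h.homotopic hv spells_empty⟩

/-- The words homotopic to `aaabb`. -/
def firstGroup (a b : α) : Fin 4 → List α :=
  ![[a, a, a, b, b], [a, a, b, b, a], [a, b, b, a, a], [b, b, a, a, a]]

/-- The desingularizations of the words in `firstGroup`. -/
def firstGroupDesing : Fin 4 → List (Fin 4) :=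
  ![[0, 1, 0, 2, 1, 2, 3, 3], [0, 1, 0, 2, 3, 3, 1, 2], [0, 1, 3, 3, 0, 2, 1, 2],
    [3, 3, 0, 1, 0, 2, 1, 2]]

/-- The words that are not homotopic to `aaabb` unless they are contractible. -/
def secondGroup (a b : α) : Fin 6 → List α :=
  ![[b, a, a, a, b], [a, b, a, b, a], [a, b, a, a, b], [b, a, a, b, a], [a, a, b, a, b],
    [b, a, b, a, a]]

/-- The desingularizations of the words in `secondGroup`. -/
def secondGroupDesing : Fin 6 → List (Fin 4) :=
  ![[3, 0, 1, 0, 2, 1, 2, 3], [0, 1, 3, 0, 2, 3, 1, 2], [0, 1, 3, 0, 2, 1, 2, 3],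
    [3, 0, 1, 0, 2, 3, 1, 2], [0, 1, 0, 2, 3, 1, 2, 3], [3, 0, 1, 3, 0, 2, 1, 2]]

theorem desingularizes_firstGroup (hab : a ≠ b) (i : Fin 4) :
    Desingularizes a b (firstGroup a b i) (firstGroupDesing i) := by
  classical
  fin_cases i <;> apply Desingularizes.of_eq <;>
    simp [firstGroup, firstGroupDesing, rawDesing, occurrences, mult_cons, mult_nil, hab, hab.symm,
      block, List.range', desingLetter, Nat.pair]

theorem desingularizes_secondGroup (hab : a ≠ b) (i : Fin 6) :
    Desingularizes a b (secondGroup a b i) (secondGroupDesing i) := by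
  classical
  fin_cases i <;> apply Desingularizes.of_eq <;>
    simp [secondGroup, secondGroupDesing, rawDesing, occurrences, mult_cons, mult_nil, hab,
      hab.symm, block, List.range', desingLetter, Nat.pair]

theorem secondGroup_injective (hab : a ≠ b) : Function.Injective (secondGroup a b) := by
  intro i j h
  fin_cases i <;> fin_cases j <;> simp_all [secondGroup]

namespace DesingHom

theorem first_group (hab : a ≠ b) (i : Fin 4) :
    DesingHom τ a b (firstGroupDesing i) [0, 1, 0, 2, 1, 2] := by
  have h := (desingularizes_firstGroup hab i).isDouble
  fin_cases i
  · exact WordHom.first (x := [0, 1, 0, 2, 1, 2].map (desingLetter a b)) (y := []) h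
  · exact WordHom.first (x := [0, 1, 0, 2].map (desingLetter a b))
      (y := [1, 2].map (desingLetter a b)) h
  · exact WordHom.first (x := [0, 1].map (desingLetter a b))
      (y := [0, 2, 1, 2].map (desingLetter a b)) h
  · exact WordHom.first (x := []) (y := [0, 1, 0, 2, 1, 2].map (desingLetter a b)) h

theorem aaa (hτ : Function.Involutive τ) (hab : a ≠ b) (ha : τ a = a) :
    DesingHom τ a b [0, 1, 0, 2, 1, 2] [] := by
  have h₁ : DesingHom τ a b [0, 1, 0, 2, 1, 2] [1, 0, 2, 0, 2, 1] :=
    WordHom.third (x := []) (y := []) (z := []) (t := [])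
      (first_group (τ := τ) hab 0).isDouble_right rfl rfl
  have h₂ : DesingHom τ a b [1, 0, 2, 0, 2, 1] [1, 1] :=
    WordHom.second' hτ (x := [1].map (desingLetter a b)) (y := [])
      (z := [1].map (desingLetter a b)) h₁.isDouble_right ha.symm
  exact h₁.trans (h₂.trans (WordHom.first (x := []) (y := []) h₂.isDouble_right))

/-- The third move on the inner `aaa` prepares two reductions: `0202` cancels when `τ a = a`, and
the outer `31⋯13` cancels when `τ a = b`. -/
theorem baaab (hab : a ≠ b) :
    DesingHom τ a b [3, 0, 1, 0, 2, 1, 2, 3] [3, 1, 0, 2, 0, 2, 1, 3] :=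
  WordHom.third (x := [3].map (desingLetter a b)) (y := []) (z := [])
    (t := [3].map (desingLetter a b)) (desingularizes_secondGroup hab 0).isDouble rfl rfl

theorem baaab_of_fixed (hτ : Function.Involutive τ) (hab : a ≠ b) (ha : τ a = a) :
    DesingHom τ a b [3, 0, 1, 0, 2, 1, 2, 3] [] := by
  have h₁ := baaab (τ := τ) hab
  have h₂ : DesingHom τ a b [3, 1, 0, 2, 0, 2, 1, 3] [3, 1, 1, 3] :=
    WordHom.second' hτ (x := [3, 1].map (desingLetter a b)) (y := [])
      (z := [1, 3].map (desingLetter a b)) h₁.isDouble_right ha.symm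
  have h₃ : DesingHom τ a b [3, 1, 1, 3] [3, 3] :=
    WordHom.first (x := [3].map (desingLetter a b)) (y := [3].map (desingLetter a b))
      h₂.isDouble_right
  exact h₁.trans (h₂.trans (h₃.trans (WordHom.first (x := []) (y := []) h₃.isDouble_right)))

theorem ababa (hτ : Function.Involutive τ) (hab : a ≠ b) (ha : τ a = b) :
    DesingHom τ a b [0, 1, 3, 0, 2, 3, 1, 2] [] := by
  have h₁ : DesingHom τ a b [0, 1, 3, 0, 2, 3, 1, 2] [0, 0, 2, 2] :=
    WordHom.second (x := [0].map (desingLetter a b)) (y := [0, 2].map (desingLetter a b))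
      (z := [2].map (desingLetter a b)) (desingularizes_secondGroup hab 1).isDouble
      (show a = τ b by rw [← ha, hτ])
  have h₂ : DesingHom τ a b [0, 0, 2, 2] [2, 2] :=
    WordHom.first (x := []) (y := [2, 2].map (desingLetter a b)) h₁.isDouble_right
  exact h₁.trans (h₂.trans (WordHom.first (x := []) (y := []) h₂.isDouble_right))

/-- Since `b = τ a`, the letter `b_{1,2}` cancels against some `a_{i,j}`. The two remaining letters
both project to `a`, so they may be renamed to `0` and `1`. -/
theorem abab_of_swap (hτ : Function.Involutive τ) (hab : a ≠ b) (ha : τ a = b) (i : Fin 6)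
    (hi : i = 0 ∨ i = 4 ∨ i = 5) : DesingHom τ a b (secondGroupDesing i) [0, 1, 0, 1] := by
  classical
  have hb : a = τ b := by rw [← ha, hτ]
  have n : desingLetter a b 0 ≠ desingLetter a b 1 ∧ desingLetter a b 0 ≠ desingLetter a b 2 ∧
      desingLetter a b 1 ≠ desingLetter a b 2 := by simp [desingLetter]
  rcases hi with rfl | rfl | rfl
  · have h₁ := baaab (τ := τ) hab
    have h₂ : DesingHom τ a b [3, 1, 0, 2, 0, 2, 1, 3] [0, 2, 0, 2] :=
      WordHom.second (x := []) (y := [0, 2, 0, 2].map (desingLetter a b)) (z := [])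
        h₁.isDouble_right ha.symm
    have h₃ := WordHom.replace (h₁.trans h₂) (A := desingLetter a b 2) (B := desingLetter a b 1)
      rfl
    have e : Equiv.swap (desingLetter a b 2) (desingLetter a b 1) (desingLetter a b 0) =
      desingLetter a b 0 := Equiv.swap_apply_of_ne_of_ne n.2.1 n.1
    simp only [List.map_cons, List.map_nil, e, Equiv.swap_apply_left] at h₃
    exact h₃
  · exact WordHom.second' hτ (x := [0, 1, 0].map (desingLetter a b))
      (y := [1].map (desingLetter a b)) (z := []) (desingularizes_secondGroup hab 4).isDouble hb
  · have h₁ : DesingHom τ a b [3, 0, 1, 3, 0, 2, 1, 2] [1, 2, 1, 2] :=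
      WordHom.second' hτ (x := []) (y := [1].map (desingLetter a b))
        (z := [2, 1, 2].map (desingLetter a b)) (desingularizes_secondGroup hab 5).isDouble ha.symm
    have h₂ := WordHom.replace h₁ (A := desingLetter a b 1) (B := desingLetter a b 0) rfl
    have e : Equiv.swap (desingLetter a b 1) (desingLetter a b 0) (desingLetter a b 2) =
      desingLetter a b 2 := Equiv.swap_apply_of_ne_of_ne n.2.2.symm n.2.1.symm
    simp only [List.map_cons, List.map_nil, e, Equiv.swap_apply_left] at h₂
    have h₃ := WordHom.replace h₂ (A := desingLetter a b 2) (B := desingLetter a b 1) rfl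
    have e : Equiv.swap (desingLetter a b 2) (desingLetter a b 1) (desingLetter a b 0) =
      desingLetter a b 0 := Equiv.swap_apply_of_ne_of_ne n.2.1 n.1
    simp only [List.map_cons, List.map_nil, e, Equiv.swap_apply_left] at h₃
    exact h₃

end DesingHom

end Desingularizes

/-! ### Dihedral actions and the resulting numerical invariants -/

section Dihedral

/-- The states: the vertices of two `n`-gons. -/
abbrev DihedralState (n : ℕ) : Type := ZMod 2 × ZMod n

/-- The rotation. -/
def rotation (n : ℕ) : Equiv.Perm (DihedralState n) where
  toFun s := (s.1, s.2 + 1)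
  invFun s := (s.1, s.2 - 1)
  left_inv s := by simp
  right_inv s := by simp

/-- The reflection that exchanges the two `n`-gons. -/
def reflection (n : ℕ) : Equiv.Perm (DihedralState n) where
  toFun s := (s.1 + 1, - s.2)
  invFun s := (s.1 + 1, - s.2)
  left_inv s := by simp [add_assoc, CharTwo.add_self_eq_zero]
  right_inv s := by simp [add_assoc, CharTwo.add_self_eq_zero]

/-- Whether the states `s ≠ t` are on the polygons `k.1` and `k.2.1` and differ by `k.2.2`. -/
def stateValue {n : ℕ} (k : ZMod 2 × ZMod 2 × ZMod n) (s t : DihedralState n) : ZMod 2 :=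
  if s ≠ t ∧ k = (s.1, t.1, t.2 - s.2) then 1 else 0

theorem stateValue_rotation {n : ℕ} (k : ZMod 2 × ZMod 2 × ZMod n) (s t : DihedralState n) :
    stateValue k (rotation n s) (rotation n t) = stateValue k s t := by
  simp only [stateValue, ne_eq, EmbeddingLike.apply_eq_iff_eq]
  simp [rotation]

variable {α : Type u} {τ : α → α} {a b : α} {n : ℕ}

open scoped Classical in
/-- The action of the letters: `a` acts as the rotation, and `b` as the reflection, unless
`b = τ a`. -/
noncomputable def dihedralAction (τ : α → α) (a b : α) (n : ℕ) (x : α) :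
    Equiv.Perm (DihedralState n) :=
  if x = a then rotation n else if x = τ a then (rotation n).symm
  else if x = b ∨ x = τ b then reflection n else Equiv.refl _

open scoped Classical in
/-- The values of the letters: only the letters `a` and `τ a` are taken into account. -/
noncomputable def dihedralValue (τ : α → α) (a : α) (k : ZMod 2 × ZMod 2 × ZMod n) (x : α)
    (s t : DihedralState n) : ZMod 2 :=
  if x = a ∨ x = τ a then stateValue k s t else 0

/-- If `τ a = a`, the letter `a` has to act as an involution, which is the content of `hn`. The
reflection is an involution anyway, so `τ b` may be arbitrary. -/
theorem dihedralAction_apply (hτ : Function.Involutive τ)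
    (hn : τ a = a → (rotation n).symm = rotation n) (x : α) :
    dihedralAction τ a b n (τ x) = (dihedralAction τ a b n x).symm := by
  have h1 : τ x = a ↔ x = τ a := hτ.eq_iff
  have h2 : τ x = τ a ↔ x = a := hτ.injective.eq_iff
  have h3 : τ x = b ↔ x = τ b := hτ.eq_iff
  have h4 : τ x = τ b ↔ x = b := hτ.injective.eq_iff
  simp only [dihedralAction]
  by_cases hx : x = a
  · by_cases hx' : x = τ a
    · rw [if_pos (h1.2 hx'), if_pos hx, hn (hx' ▸ hx)]
    · rw [if_neg (mt h1.1 hx'), if_pos (h2.2 hx), if_pos hx]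
  · by_cases hx' : x = τ a
    · rw [if_pos (h1.2 hx'), if_neg hx, if_pos hx', Equiv.symm_symm]
    · rw [if_neg (mt h1.1 hx'), if_neg (mt h2.1 hx), if_neg hx, if_neg hx']
      by_cases hb : x = b ∨ x = τ b
      · rw [if_pos (hb.symm.imp h3.2 h4.2), if_pos hb]
        rfl
      · rw [if_neg fun h => hb (h.symm.imp h4.1 h3.1), if_neg hb]
        rfl

-- Only `a` and `τ a` have nonzero values, so invariance under the rotation is all that `h_shift`
-- asks. They have the same values, so `h_inv` holds modulo two.
open scoped Classical in
theorem isWordInvariant_dihedral (hτ : Function.Involutive τ)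
    (hn : τ a = a → (rotation n).symm = rotation n) (k : ZMod 2 × ZMod 2 × ZMod n) :
    IsWordInvariant τ fun _ p w =>
      letterSum (dihedralAction τ a b n ∘ p) (dihedralValue τ a k ∘ p) (0, 0) w := by
  refine isWordInvariant_letterSum (dihedralAction_apply hτ hn) (fun x s => ?_) (fun x s t => ?_)
    (fun x s t => ?_) _
  · simp [dihedralValue, stateValue]
  · by_cases hx : x = a ∨ x = τ a
    · simp only [dihedralValue, if_pos hx]
      by_cases hxa : x = a
      · simp only [dihedralAction, if_pos hxa, stateValue_rotation]
      · rw [dihedralAction, if_neg hxa, if_pos (hx.resolve_left hxa), ← stateValue_rotation,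
          Equiv.apply_symm_apply, Equiv.apply_symm_apply]
    · simp only [dihedralValue, if_neg hx]
  · have h1 : τ x = a ↔ x = τ a := hτ.eq_iff
    have h2 : τ x = τ a ↔ x = a := hτ.injective.eq_iff
    simp only [dihedralValue, h1, h2, or_comm]
    exact CharTwo.add_self_eq_zero _

/-- The letters `0`, `1`, `2` act as the rotation and the letter `3` acts as `r`; the values of
the letters `0`, `1`, `2`, and also of `3` if `c` is true, are added up. -/
def dihedralCode (r : Equiv.Perm (DihedralState n)) (c : Bool) (W : List (Fin 4))
    (k : ZMod 2 × ZMod 2 × ZMod n) : ZMod 2 :=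
  letterSum ![rotation n, rotation n, rotation n, r]
    ![stateValue k, stateValue k, stateValue k, if c then stateValue k else fun _ _ => 0] (0, 0) W

theorem DesingHom.invariant_eq {R : Type*} {I : ∀ ⦃L : Type u⦄, (L → α) → List L → R}
    (hI : IsWordInvariant τ I) {V W : List (Fin 4)} (h : DesingHom τ a b V W) :
    I Prod.snd (V.map (desingLetter a b)) = I Prod.snd (W.map (desingLetter a b)) := by
  obtain ⟨U, U', hU, hU', h⟩ := h
  rw [← hI.eq_of_spells hU, ← hI.eq_of_spells hU', hI.eq_of_homotopic h]

/-- Transport along `desingLetter` removes `α` from the invariant and leaves a computation over `Fin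
4`. -/
theorem DesingHom.letterSum_eq {Q R : Type*} [AddCommGroup R] {ρ : α → Equiv.Perm Q}
    {μ : α → Q → Q → R} {q : Q}
    (hI : IsWordInvariant τ fun _ p w => open scoped Classical in
      letterSum (ρ ∘ p) (μ ∘ p) q w) (hab : a ≠ b)
    {V W : List (Fin 4)} (h : DesingHom τ a b V W) :
    letterSum ![ρ a, ρ a, ρ a, ρ b] ![μ a, μ a, μ a, μ b] q V =
      letterSum ![ρ a, ρ a, ρ a, ρ b] ![μ a, μ a, μ a, μ b] q W := by
  classical
  have e : letterSum (ρ ∘ Prod.snd) (μ ∘ Prod.snd) q (V.map (desingLetter a b)) =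
      letterSum (ρ ∘ Prod.snd) (μ ∘ Prod.snd) q (W.map (desingLetter a b)) := by
    convert h.invariant_eq hI
  have e₁ : (ρ ∘ Prod.snd) ∘ desingLetter a b = ![ρ a, ρ a, ρ a, ρ b] := by
    funext i
    fin_cases i <;> rfl
  have e₂ : (μ ∘ Prod.snd) ∘ desingLetter a b = ![μ a, μ a, μ a, μ b] := by
    funext i
    fin_cases i <;> rfl
  simpa only [letterSum_map (desingLetter_injective hab), e₁, e₂] using e

theorem DesingHom.dihedralCode_eq (hτ : Function.Involutive τ) (hab : a ≠ b)
    (hn : τ a = a → (rotation n).symm = rotation n) (hb : τ a ≠ b) {V W : List (Fin 4)}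
    (h : DesingHom τ a b V W) (k : ZMod 2 × ZMod 2 × ZMod n) :
    dihedralCode (reflection n) false V k = dihedralCode (reflection n) false W k := by
  have e := h.letterSum_eq (isWordInvariant_dihedral (b := b) hτ hn k) hab
  have hba : ¬ (b = a ∨ b = τ a) := fun h => h.elim hab.symm hb.symm
  have e₁ : dihedralAction τ a b n b = reflection n := by
    simp [dihedralAction, hab.symm, hb.symm]
  have e₂ : dihedralAction τ a b n a = rotation n := by simp [dihedralAction]
  have e₃ : dihedralValue τ a k a = stateValue k := by
    funext s t
    simp [dihedralValue]
  have e₄ : dihedralValue τ a k b = fun _ _ => 0 := by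
    funext s t
    rw [dihedralValue, if_neg hba]
  simpa only [dihedralCode, Bool.false_eq_true, if_false, if_true, e₁, e₂, e₃, e₄] using e

theorem DesingHom.dihedralCode_eq_of_swap (hτ : Function.Involutive τ) (hab : a ≠ b)
    (hb : τ a = b) {V W : List (Fin 4)} (h : DesingHom τ a b V W)
    (k : ZMod 2 × ZMod 2 × ZMod n) :
    dihedralCode (rotation n).symm true V k = dihedralCode (rotation n).symm true W k := by
  have e := h.letterSum_eq (isWordInvariant_dihedral (b := b) hτ
    (fun h => absurd (h.symm.trans hb) hab) k) hab
  have e₁ : dihedralAction τ a b n b = (rotation n).symm := by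
    simp [dihedralAction, hab.symm, hb]
  have e₂ : dihedralAction τ a b n a = rotation n := by simp [dihedralAction]
  have e₃ : dihedralValue τ a k a = stateValue k := by
    funext s t
    simp [dihedralValue]
  have e₄ : dihedralValue τ a k b = stateValue k := by
    funext s t
    simp [dihedralValue, hb]
  simpa only [dihedralCode, Bool.false_eq_true, if_false, if_true, e₁, e₂, e₃, e₄] using e

theorem DesingHom.pairSum_eq (hτ : Function.Involutive τ) (hab : a ≠ b) (hb : τ a = b)
    {V W : List (Fin 4)} (h : DesingHom τ a b V W) :
    pairSum ![1, 1, 1, -1] (1 : ZMod 3) V = pairSum ![1, 1, 1, -1] (1 : ZMod 3) W := by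
  classical
  have hb' : τ b = a := by rw [← hb, hτ]
  -- The labelling is odd under `τ`, because `τ` exchanges `a` and `b`.
  let ε : α → ZMod 3 := fun x => if x = a then 1 else if x = b then -1 else 0
  have hε (x : α) : ε (τ x) = - ε x := by
    have h1 : τ x = a ↔ x = b := by rw [hτ.eq_iff, hb]
    have h2 : τ x = b ↔ x = a := by rw [hτ.eq_iff, hb']
    simp only [ε, h1, h2]
    by_cases h3 : x = a
    · simp [h3, hab]
    · by_cases h4 : x = b <;> simp [h3, h4, hab.symm]
  have e : pairSum (ε ∘ Prod.snd) 1 (V.map (desingLetter a b)) =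
      pairSum (ε ∘ Prod.snd) 1 (W.map (desingLetter a b)) := by
    convert h.invariant_eq (isWordInvariant_pairSum hε (g := 1) (by decide))
  have e₁ : (ε ∘ Prod.snd) ∘ desingLetter a b = ![1, 1, 1, -1] := by
    funext i
    fin_cases i <;> simp [ε, desingLetter, hab.symm]
  simpa only [pairSum_map (desingLetter_injective hab), e₁] using e

end Dihedral

/-! ### Evaluation of the invariants, and the case distinction on `τ a` -/

section Classification

set_option maxRecDepth 100000

/-- For the case `τ a = a`: the rotation is an involution for `n = 2`, and three of the invariants
already separate the six words. -/
theorem dihedralCode_two_injective (i j : Fin 6) :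
    (∀ k ∈ [((0 : ZMod 2), (1 : ZMod 2), (1 : ZMod 2)), (1, 1, 1), (0, 0, 1)],
      dihedralCode (reflection 2) false (secondGroupDesing i) k =
        dihedralCode (reflection 2) false (secondGroupDesing j) k) → i = j := by
  revert i j
  decide

theorem dihedralCode_two_eq_nil (i : Fin 6) :
    (∀ k ∈ [((0 : ZMod 2), (1 : ZMod 2), (1 : ZMod 2)), (1, 1, 1), (0, 0, 1)],
      dihedralCode (reflection 2) false (secondGroupDesing i) k =
        dihedralCode (reflection 2) false [] k) → i = 0 := by
  revert i
  decide

/-- For the case `τ a ≠ a, b`, where the rotation may have order greater than two. -/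
theorem dihedralCode_five_injective (i j : Fin 6) :
    (∀ k ∈ [((0 : ZMod 2), (0 : ZMod 2), (1 : ZMod 5)), (1, 1, 4), (0, 1, 2), (1, 0, 1),
        (0, 1, 1), (1, 0, 0)],
      dihedralCode (reflection 5) false (secondGroupDesing i) k =
        dihedralCode (reflection 5) false (secondGroupDesing j) k) → i = j := by
  revert i j
  decide

theorem dihedralCode_five_ne (i : Fin 6) (W : List (Fin 4)) (hW : W ∈ [[], [0, 1, 0, 2, 1, 2]]) :
    ¬ ∀ k ∈ [((0 : ZMod 2), (0 : ZMod 2), (1 : ZMod 5)), (1, 1, 4), (0, 1, 2), (1, 0, 1),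
        (0, 1, 1), (1, 0, 0)],
      dihedralCode (reflection 5) false (secondGroupDesing i) k =
        dihedralCode (reflection 5) false W k := by
  revert i W
  decide

theorem dihedralCode_five_aaa :
    dihedralCode (reflection 5) false [0, 1, 0, 2, 1, 2] (0, 0, 1) ≠
      dihedralCode (reflection 5) false [] (0, 0, 1) := by
  decide

/-- For the case `τ a = b`. The indices `0`, `4`, `5` belong to words that are then homotopic, so no
finer separation is possible. -/
theorem dihedralCode_swap_eq (i j : Fin 6) :
    (∀ k ∈ [((0 : ZMod 2), (0 : ZMod 2), (1 : ZMod 5)), (0, 0, 2), (0, 0, 3)],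
      dihedralCode (rotation 5).symm true (secondGroupDesing i) k =
        dihedralCode (rotation 5).symm true (secondGroupDesing j) k) →
    i = j ∨ (i = 0 ∨ i = 4 ∨ i = 5) ∧ (j = 0 ∨ j = 4 ∨ j = 5) := by
  revert i j
  decide

theorem dihedralCode_swap_eq_nil (i : Fin 6) :
    (∀ k ∈ [((0 : ZMod 2), (0 : ZMod 2), (1 : ZMod 5)), (0, 0, 2), (0, 0, 3)],
      dihedralCode (rotation 5).symm true (secondGroupDesing i) k =
        dihedralCode (rotation 5).symm true [] k) → i = 1 := by
  revert i
  decide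

theorem dihedralCode_swap_aaa :
    dihedralCode (rotation 5).symm true [0, 1, 0, 2, 1, 2] (0, 0, 1) ≠
      dihedralCode (rotation 5).symm true [] (0, 0, 1) := by
  decide

/-- The letter sums of `aaa` coincide with those of the words `0`, `4`, `5`, which reduce to `0101`.
There no letter has displacement zero and `pairSum` vanishes. In `aaa` the letter `1` has
displacement zero, and `0`, of displacement one, enters between its entries; this is the only pair.
-/
theorem swap_ne_aaa (i : Fin 6) :
    ¬ ((∀ k ∈ [((0 : ZMod 2), (0 : ZMod 2), (1 : ZMod 5)), (0, 0, 2), (0, 0, 3)],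
      dihedralCode (rotation 5).symm true (secondGroupDesing i) k =
        dihedralCode (rotation 5).symm true [0, 1, 0, 2, 1, 2] k) ∧
      pairSum ![1, 1, 1, -1] (1 : ZMod 3) (secondGroupDesing i) =
        pairSum ![1, 1, 1, -1] (1 : ZMod 3) [0, 1, 0, 2, 1, 2]) := by
  revert i
  decide

theorem rotation_two_symm : (rotation 2).symm = rotation 2 := by
  decide

variable {α : Type u} {τ : α → α} {a b : α}

namespace DesingHom

theorem aaa_iff (hτ : Function.Involutive τ) (hab : a ≠ b) :
    DesingHom τ a b [0, 1, 0, 2, 1, 2] [] ↔ τ a = a := by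
  refine ⟨fun h => ?_, aaa hτ hab⟩
  by_contra ha
  by_cases hb : τ a = b
  · exact dihedralCode_swap_aaa (h.dihedralCode_eq_of_swap hτ hab hb _)
  · exact dihedralCode_five_aaa (h.dihedralCode_eq hτ hab (fun h => absurd h ha) hb _)

theorem secondGroup_nil (hτ : Function.Involutive τ) (hab : a ≠ b) (i : Fin 6) :
    DesingHom τ a b (secondGroupDesing i) [] ↔ i = 0 ∧ τ a = a ∨ i = 1 ∧ τ a = b := by
  refine ⟨fun h => ?_, ?_⟩
  · by_cases hb : τ a = b
    · exact .inr ⟨dihedralCode_swap_eq_nil i fun k _ => h.dihedralCode_eq_of_swap hτ hab hb k, hb⟩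
    by_cases ha : τ a = a
    · exact .inl ⟨dihedralCode_two_eq_nil i fun k _ =>
        h.dihedralCode_eq hτ hab (fun _ => rotation_two_symm) hb k, ha⟩
    · exact (dihedralCode_five_ne i [] (by simp) fun k _ =>
        h.dihedralCode_eq hτ hab (fun h => absurd h ha) hb k).elim
  · rintro (⟨rfl, ha⟩ | ⟨rfl, hb⟩)
    · exact baaab_of_fixed hτ hab ha
    · exact ababa hτ hab hb

/-- Enough to keep the two groups apart: if `τ a = a`, then `aaa` is contractible, and so is
anything homotopic to it. -/
theorem fixed_of_secondGroup_aaa (hτ : Function.Involutive τ) (hab : a ≠ b) (i : Fin 6)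
    (h : DesingHom τ a b (secondGroupDesing i) [0, 1, 0, 2, 1, 2]) : τ a = a := by
  by_contra ha
  by_cases hb : τ a = b
  · exact swap_ne_aaa i ⟨fun k _ => h.dihedralCode_eq_of_swap hτ hab hb k,
      h.pairSum_eq hτ hab hb⟩
  · exact dihedralCode_five_ne i [0, 1, 0, 2, 1, 2] (by simp) fun k _ =>
      h.dihedralCode_eq hτ hab (fun h => absurd h ha) hb k

theorem secondGroup_iff (hτ : Function.Involutive τ) (hab : a ≠ b) (i j : Fin 6) :
    DesingHom τ a b (secondGroupDesing i) (secondGroupDesing j) ↔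
      i = j ∨ τ a = b ∧ (i = 4 ∨ i = 5 ∨ i = 0) ∧ (j = 4 ∨ j = 5 ∨ j = 0) := by
  refine ⟨fun h => ?_, ?_⟩
  · by_cases hb : τ a = b
    · have := dihedralCode_swap_eq i j fun k _ => h.dihedralCode_eq_of_swap hτ hab hb k
      tauto
    left
    by_cases ha : τ a = a
    · exact dihedralCode_two_injective i j fun k _ =>
        h.dihedralCode_eq hτ hab (fun _ => rotation_two_symm) hb k
    · exact dihedralCode_five_injective i j fun k _ =>
        h.dihedralCode_eq hτ hab (fun h => absurd h ha) hb k
  · rintro (rfl | ⟨hb, hi, hj⟩)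
    · exact WordHom.refl (desingularizes_secondGroup hab i).isDouble
    · exact (abab_of_swap hτ hab hb i (by tauto)).trans (abab_of_swap hτ hab hb j (by tauto)).symm

end DesingHom

theorem mem_firstGroup {w : List α}
    (h : w ∈ ({[a, a, a, b, b], [a, a, b, b, a], [a, b, b, a, a], [b, b, a, a, a]} :
      Set (List α))) : ∃ i, w = firstGroup a b i := by
  rcases h with rfl | rfl | rfl | rfl
  exacts [⟨0, rfl⟩, ⟨1, rfl⟩, ⟨2, rfl⟩, ⟨3, rfl⟩]

theorem mem_secondGroup {w : List α}
    (h : w ∈ ({[b, a, a, a, b], [a, b, a, b, a], [a, b, a, a, b], [b, a, a, b, a],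
      [a, a, b, a, b], [b, a, b, a, a]} : Set (List α))) : ∃ i, w = secondGroup a b i := by
  rcases h with rfl | rfl | rfl | rfl | rfl | rfl
  exacts [⟨0, rfl⟩, ⟨1, rfl⟩, ⟨2, rfl⟩, ⟨3, rfl⟩, ⟨4, rfl⟩, ⟨5, rfl⟩]

theorem secondGroup_mem_iff (hab : a ≠ b) (i : Fin 6) :
    secondGroup a b i ∈ ({[a, a, b, a, b], [b, a, b, a, a], [b, a, a, a, b]} : Set (List α)) ↔
      i = 4 ∨ i = 5 ∨ i = 0 := by
  have h := secondGroup_injective hab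
  exact or_congr (h.eq_iff (b := 4)) (or_congr (h.eq_iff (b := 5)) (h.eq_iff (b := 0)))

end Classification

end Nano

theorem mainTheorem1 {α : Type*} (τ : α → α) (hτ : Function.Involutive τ) (a b : α)
    (hab : a ≠ b) :
    -- the words homotopic to each other
    ((∀ u ∈ ({[a, a, a, b, b], [a, a, b, b, a], [a, b, b, a, a], [b, b, a, a, a]} :
          Set (List α)),
        (∀ v ∈ ({[a, a, a, b, b], [a, a, b, b, a], [a, b, b, a, a], [b, b, a, a, a]} :
            Set (List α)), Nano.Homotopic τ u v) ∧
        (Nano.Contractible τ u ↔ τ a = a))) ∧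
    -- `baaab`
    (Nano.Contractible τ [b, a, a, a, b] ↔ τ a = a) ∧
    -- `ababa`
    (Nano.Contractible τ [a, b, a, b, a] ↔ τ a = b) ∧
    -- the words that are never contractible
    (∀ u ∈ ({[a, b, a, a, b], [b, a, a, b, a], [a, a, b, a, b], [b, a, b, a, a]} :
        Set (List α)), ¬ Nano.Contractible τ u) ∧
    -- no homotopy between the two groups of words
    (∀ u ∈ ({[b, a, a, a, b], [a, b, a, b, a], [a, b, a, a, b], [b, a, a, b, a],
          [a, a, b, a, b], [b, a, b, a, a]} : Set (List α)),
      ¬ Nano.Contractible τ u →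
      ∀ v ∈ ({[a, a, a, b, b], [a, a, b, b, a], [a, b, b, a, a], [b, b, a, a, a]} :
          Set (List α)), ¬ Nano.Homotopic τ u v) ∧
    -- the homotopies in the second group
    (∀ u ∈ ({[b, a, a, a, b], [a, b, a, b, a], [a, b, a, a, b], [b, a, a, b, a],
          [a, a, b, a, b], [b, a, b, a, a]} : Set (List α)),
      ∀ v ∈ ({[b, a, a, a, b], [a, b, a, b, a], [a, b, a, a, b], [b, a, a, b, a],
          [a, a, b, a, b], [b, a, b, a, a]} : Set (List α)),
      ¬ Nano.Contractible τ u → ¬ Nano.Contractible τ v →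
      (Nano.Homotopic τ u v ↔
        u = v ∨
        (τ a = b ∧
          u ∈ ({[a, a, b, a, b], [b, a, b, a, a], [b, a, a, a, b]} : Set (List α)) ∧
          v ∈ ({[a, a, b, a, b], [b, a, b, a, a], [b, a, a, a, b]} : Set (List α))))) := by
  have d₁ := Nano.desingularizes_firstGroup hab
  have d₂ := Nano.desingularizes_secondGroup hab
  have g := Nano.DesingHom.first_group (τ := τ) hab
  have c (i : Fin 6) : Nano.Contractible τ (Nano.secondGroup a b i) ↔
      i = 0 ∧ τ a = a ∨ i = 1 ∧ τ a = b :=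
    (d₂ i).contractible_iff.trans (Nano.DesingHom.secondGroup_nil hτ hab i)
  refine ⟨fun u hu => ⟨fun v hv => ?_, ?_⟩, ?_, ?_, fun u hu => ?_, fun u hu hu' v hv h => ?_,
    fun u hu v hv _ _ => ?_⟩
  · obtain ⟨i, rfl⟩ := Nano.mem_firstGroup hu
    obtain ⟨j, rfl⟩ := Nano.mem_firstGroup hv
    exact ((d₁ i).homotopic_iff (d₁ j)).2 ((g i).trans (g j).symm)
  · obtain ⟨i, rfl⟩ := Nano.mem_firstGroup hu
    rw [(d₁ i).contractible_iff, ← Nano.DesingHom.aaa_iff hτ hab]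
    exact ⟨(g i).symm.trans, (g i).trans⟩
  · exact (c 0).trans (by simp)
  · exact (c 1).trans (by simp)
  · rcases hu with rfl | rfl | rfl | rfl
    exacts [fun h => by simpa using (c 2).1 h, fun h => by simpa using (c 3).1 h,
      fun h => by simpa using (c 4).1 h, fun h => by simpa using (c 5).1 h]
  · obtain ⟨i, rfl⟩ := Nano.mem_secondGroup hu
    obtain ⟨j, rfl⟩ := Nano.mem_firstGroup hv
    have h' := (((d₂ i).homotopic_iff (d₁ j)).1 h).trans (g j)
    have ha := Nano.DesingHom.fixed_of_secondGroup_aaa hτ hab i h'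
    exact hu' ((d₂ i).contractible_iff.2 (h'.trans (Nano.DesingHom.aaa hτ hab ha)))
  · obtain ⟨i, rfl⟩ := Nano.mem_secondGroup hu
    obtain ⟨j, rfl⟩ := Nano.mem_secondGroup hv
    rw [(d₂ i).homotopic_iff (d₂ j), Nano.DesingHom.secondGroup_iff hτ hab,
      (Nano.secondGroup_injective hab).eq_iff, Nano.secondGroup_mem_iff hab,
      Nano.secondGroup_mem_iff hab]
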